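/- For $n\ge 0$ let $\mathcal I_n$ be the set of permutations $\pi$ of $\{1,\dots,n\}$ with $\pi=\pi^{-1}$. An occurrence of $3412$ in $\pi$ is a choice of positions $1\le i_1<i_2<i_3<i_4\le n$ such that $(\pi(i_1),\pi(i_2),\pi(i_3),\pi(i_4))$ is order-isomorphic to $(3,4,1,2)$, i.e. $\pi(i_3)<\pi(i_4)<\pi(i_1)<\pi(i_2)$. Let $a_n$ be the number of $\pi\in\mathcal I_n$ that have exactly two occurrences of $3412$. Then, as formal Laurent series over $\mathbb Q$, $$\sum_{n\ge 0} a_n x^n=\frac{1-2x}{2x^2(1-x)}-\frac{1-6x+8x^2+8x^3-15x^4-2x^5+4x^6}{2x^2(1-x)^2\,\bigl(\sqrt{1-2x-3x^2}\bigr)^{3}},$$ where $\sqrt{1-2x-3x^2}$ denotes the formal power series with constant coefficient $1$ whose square is $1-2x-3x^2$. -/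

import Mathlib

open scoped PowerSeries LaurentSeries

namespace PatternInvolutions

/-- An occurrence of `τ` in `π`: a choice of positions `f 0 < ⋯ < f (m-1)` (an order embedding
`Fin m ↪o Fin n`) such that the sequence `π (f 0), …, π (f (m-1))` is order-isomorphic
to `τ 0, …, τ (m-1)`. -/
def IsOccurrence {m n : ℕ} (τ : Equiv.Perm (Fin m)) (π : Equiv.Perm (Fin n))
    (f : Fin m ↪o Fin n) : Prop :=
  ∀ a b : Fin m, τ a < τ b ↔ π (f a) < π (f b)

/-- The number of occurrences of the pattern `τ` in the permutation `π`. -/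
noncomputable def occurrences {m n : ℕ} (τ : Equiv.Perm (Fin m)) (π : Equiv.Perm (Fin n)) : ℕ :=
  Nat.card {f : Fin m ↪o Fin n // IsOccurrence τ π f}

/-- The pattern `3412`, in one-line notation on the letters `0, 1, 2, 3`. -/
def pattern3412 : Equiv.Perm (Fin 4) where
  toFun := ![2, 3, 0, 1]
  invFun := ![2, 3, 0, 1]
  left_inv := by decide
  right_inv := by decide

/-- The number of involutions `π = π⁻¹` on `n` letters that contain `3412` exactly `r` times. -/
noncomputable def involutionCount (r n : ℕ) : ℕ :=
  Nat.card {π : Equiv.Perm (Fin n) // π = π⁻¹ ∧ occurrences pattern3412 π = r}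

/-- The generating function `∑ₙ (involutionCount r n) xⁿ`, as a formal power series. -/
noncomputable def involutionGF (r : ℕ) : ℚ⟦X⟧ :=
  PowerSeries.mk fun n => (involutionCount r n : ℚ)

/-- The square root with constant coefficient `1` of a formal power series `f` whose constant
coefficient is `1`, given by the binomial series `(1 + u) ^ (1/2)` at `u = f - 1`. -/
noncomputable def sqrtSeries (f : ℚ⟦X⟧) : ℚ⟦X⟧ :=
  (PowerSeries.binomialSeries ℚ (1 / 2 : ℚ)).subst (f - 1)

theorem hasSubst_sub_one {f : ℚ⟦X⟧} (hf : PowerSeries.constantCoeff f = 1) :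
    PowerSeries.HasSubst (f - 1) :=
  PowerSeries.HasSubst.of_constantCoeff_zero' (by simp [hf])

theorem sqrtSeries_sq {f : ℚ⟦X⟧} (hf : PowerSeries.constantCoeff f = 1) :
    sqrtSeries f ^ 2 = f := by
  have h := hasSubst_sub_one hf
  have e : PowerSeries.binomialSeries ℚ (1 / 2 : ℚ) ^ 2 = 1 + PowerSeries.X := by
    rw [sq, ← PowerSeries.binomialSeries_add, add_halves, ← Nat.cast_one,
      PowerSeries.binomialSeries_nat, pow_one]
  rw [sqrtSeries, ← PowerSeries.subst_pow h, e, ← PowerSeries.coe_substAlgHom h, map_add, map_one,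
    PowerSeries.substAlgHom_X h]
  ring

theorem constantCoeff_sqrtSeries {f : ℚ⟦X⟧} (hf : PowerSeries.constantCoeff f = 1) :
    PowerSeries.constantCoeff (sqrtSeries f) = 1 := by
  have h0 : PowerSeries.constantCoeff
      ((PowerSeries.binomialSeries ℚ (1 / 2 : ℚ) - 1).subst (f - 1) : ℚ⟦X⟧) = 0 :=
    PowerSeries.constantCoeff_subst_eq_zero
      (show PowerSeries.constantCoeff (f - 1) = 0 by simp [hf]) _ (by simp)
  rw [PowerSeries.subst_sub (hasSubst_sub_one hf), map_sub, sub_eq_zero] at h0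
  have h1 : ((1 : ℚ⟦X⟧).subst (f - 1) : ℚ⟦X⟧) = 1 := by
    rw [← PowerSeries.coe_substAlgHom (hasSubst_sub_one hf), map_one]
  rw [sqrtSeries]
  exact h0.trans (by rw [h1, map_one])

end PatternInvolutions

/-! View an involution as a diagram of arcs joining i to π(i), with fixed points. Two crossing arcs
give an occurrence of 3412, and three pairwise distinct occurrences are too many. This rigidity
leaves only five forms at the first point: nothing there; a fixed point; an arc that no arc crosses;
two crossing arcs; or a chain of three arcs, each crossing the next. A second arc crossing the same
arc from the same side would force a third occurrence (`not_two_cross_right`, `not_two_cross_left`).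
So would an ascent under both arcs of a crossing, so π reverses the points there (`anti_of_cross`).
All other intervals cut out by the arcs are invariant and carry arbitrary involutions. This is
`exists_decomposition`.

Conversely, every gluing of these pieces exists, is determined by its pieces, determines them, and
has 0, 1 or 2 occurrences beyond those of its pieces (`IsArc.occ_eq`, `IsCross.occ_eq`,
`IsChain.occ_eq`). Hence the series m, a, b for 0, 1, 2 occurrences satisfy a Motzkin quadratic for
m and equations linear in a and then in b, where a factor 1/(1-x) counts the length of each reversed
run. The coefficient of both a and b is s = 1 - x - 2x²m, which is the square root of the
discriminant 1 - 2x - 3x². Eliminating m through x²m = (1-x-s)/2 gives the formula. -/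

namespace PatternInvolutions

/-! ### Generating functions of weighted combinatorial classes -/

/-- A combinatorial class: finitely many objects of each size, every object carrying a weight. -/
class Graded (α : Type) where
  size : α → ℕ
  weight : α → ℕ
  finite_size : ∀ n, {a : α | size a = n}.Finite

/-- The objects of size `n` and weight `r`. -/
def Graded.level (α : Type) [Graded α] (r n : ℕ) : Set α :=
  {a | Graded.size a = n ∧ Graded.weight a = r}

theorem Graded.finite_level (α : Type) [Graded α] (r n : ℕ) : (Graded.level α r n).Finite :=
  (Graded.finite_size n).subset fun _ h => h.1

/-- The generating function by size of the objects of weight `r`. -/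
noncomputable def gradedGF (α : Type) [Graded α] (r : ℕ) : ℚ⟦X⟧ :=
  PowerSeries.mk fun n => ((Graded.level α r n).ncard : ℚ)

instance {α β : Type} [Graded α] [Graded β] : Graded (α ⊕ β) where
  size := Sum.elim Graded.size Graded.size
  weight := Sum.elim Graded.weight Graded.weight
  finite_size n := by
    refine (((Graded.finite_size (α := α) n).image Sum.inl).union
      ((Graded.finite_size (α := β) n).image Sum.inr)).subset ?_
    rintro (a | b) h
    · exact Or.inl ⟨a, h, rfl⟩
    · exact Or.inr ⟨b, h, rfl⟩

instance {α β : Type} [Graded α] [Graded β] : Graded (α × β) where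
  size p := Graded.size p.1 + Graded.size p.2
  weight p := Graded.weight p.1 + Graded.weight p.2
  finite_size n := by
    refine (((Set.finite_Iic n).biUnion fun i _ => Graded.finite_size (α := α) i).prod
      ((Set.finite_Iic n).biUnion fun i _ => Graded.finite_size (α := β) i)).subset ?_
    rintro ⟨a, b⟩ h
    simp only [Set.mem_ofPred_eq] at h
    simp only [Set.mem_prod, Set.mem_iUnion, Set.mem_Iic, Set.mem_ofPred_eq]
    exact ⟨⟨_, by omega, rfl⟩, ⟨_, by omega, rfl⟩⟩

/-- Models the length of a reversed run of points: it adds to the size but creates no occurrence. -/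
instance : Graded ℕ where
  size := id
  weight _ := 0
  finite_size n := Set.finite_singleton n

/-- A single object of size `k` and weight `j`. -/
inductive Atom (k j : ℕ) : Type
  | mk

instance (k j : ℕ) : Graded (Atom k j) where
  size _ := k
  weight _ := j
  finite_size _ := (Set.finite_singleton Atom.mk).subset fun ⟨⟩ _ => rfl

theorem gradedGF_sum (α β : Type) [Graded α] [Graded β] (r : ℕ) :
    gradedGF (α ⊕ β) r = gradedGF α r + gradedGF β r := by
  ext n
  have h : Graded.level (α ⊕ β) r n =
      Sum.inl '' Graded.level α r n ∪ Sum.inr '' Graded.level β r n := by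
    ext (a | b)
    · simp [Graded.level, Graded.size, Graded.weight]
    · simp [Graded.level, Graded.size, Graded.weight]
  have hd : Disjoint (Sum.inl '' Graded.level α r n : Set (α ⊕ β))
      (Sum.inr '' Graded.level β r n) := by
    rw [Set.disjoint_left]
    rintro _ ⟨a, _, rfl⟩ ⟨b, _, hb⟩
    cases hb
  simp only [gradedGF, PowerSeries.coeff_mk, map_add]
  rw [h, Set.ncard_union_eq hd ((Graded.finite_level α r n).image _)
    ((Graded.finite_level β r n).image _), Set.ncard_image_of_injective _ Sum.inl_injective,
    Set.ncard_image_of_injective _ Sum.inr_injective, Nat.cast_add]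

theorem gradedGF_prod (α β : Type) [Graded α] [Graded β] (r : ℕ) :
    gradedGF (α × β) r =
      ∑ p ∈ Finset.HasAntidiagonal.antidiagonal r, gradedGF α p.1 * gradedGF β p.2 := by
  classical
  ext n
  have h : (Graded.finite_level (α × β) r n).toFinset =
      (Finset.HasAntidiagonal.antidiagonal r ×ˢ Finset.HasAntidiagonal.antidiagonal n).biUnion fun p =>
        (Graded.finite_level α p.1.1 p.2.1).toFinset ×ˢ
          (Graded.finite_level β p.1.2 p.2.2).toFinset := by
    ext ⟨a, b⟩
    simp only [Set.Finite.mem_toFinset, Finset.mem_biUnion, Finset.mem_product,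
      Finset.HasAntidiagonal.mem_antidiagonal, Prod.exists, Graded.level, Set.mem_ofPred_eq]
    constructor
    · rintro ⟨h1, h2⟩
      exact ⟨_, _, _, _, ⟨h2, h1⟩, ⟨rfl, rfl⟩, rfl, rfl⟩
    · rintro ⟨_, _, _, _, ⟨h2, h1⟩, ⟨rfl, rfl⟩, rfl, rfl⟩
      exact ⟨h1, h2⟩
  have hd : ((Finset.HasAntidiagonal.antidiagonal r ×ˢ Finset.HasAntidiagonal.antidiagonal n : Finset _) :
      Set ((ℕ × ℕ) × ℕ × ℕ)).PairwiseDisjoint fun p =>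
        (Graded.finite_level α p.1.1 p.2.1).toFinset ×ˢ
          (Graded.finite_level β p.1.2 p.2.2).toFinset := by
    rintro ⟨⟨i, j⟩, k, l⟩ _ ⟨⟨i', j'⟩, k', l'⟩ _ hne
    rw [Function.onFun, Finset.disjoint_left]
    rintro ⟨a, b⟩ h1 h2
    simp only [Set.Finite.mem_toFinset, Finset.mem_product, Graded.level,
      Set.mem_ofPred_eq] at h1 h2
    apply hne
    simp only [Prod.mk.injEq]
    omega
  simp only [gradedGF, map_sum, PowerSeries.coeff_mul, PowerSeries.coeff_mk]
  rw [Set.ncard_eq_toFinset_card _ (Graded.finite_level (α × β) r n), h,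
    Finset.card_biUnion hd, Finset.sum_product, Nat.cast_sum]
  refine Finset.sum_congr rfl fun p _ => ?_
  rw [Nat.cast_sum]
  refine Finset.sum_congr rfl fun q _ => ?_
  rw [Finset.card_product, Nat.cast_mul, Set.ncard_eq_toFinset_card _ (Graded.finite_level α _ _),
    Set.ncard_eq_toFinset_card _ (Graded.finite_level β _ _)]

theorem gradedGF_atom (k j r : ℕ) :
    gradedGF (Atom k j) r = if r = j then PowerSeries.X ^ k else 0 := by
  ext n
  have h : Graded.level (Atom k j) r n = if r = j ∧ n = k then {Atom.mk} else ∅ := by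
    ext ⟨⟩
    split_ifs with h
    · simp [Graded.level, Graded.size, Graded.weight, h]
    · simp [Graded.level, Graded.size, Graded.weight]
      omega
  simp only [gradedGF, PowerSeries.coeff_mk, h]
  by_cases h1 : r = j <;> by_cases h2 : n = k <;> simp [h1, h2, PowerSeries.coeff_X_pow]

theorem gradedGF_nat_zero : gradedGF ℕ 0 = PowerSeries.mk 1 := by
  ext n
  have h : Graded.level ℕ 0 n = {n} := by
    ext m
    simp [Graded.level, Graded.size, Graded.weight]
  simp [gradedGF, h]

theorem gradedGF_nat_succ (r : ℕ) : gradedGF ℕ (r + 1) = 0 := by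
  ext n
  have h : Graded.level ℕ (r + 1) n = ∅ := by
    ext m
    simp [Graded.level, Graded.weight]
  simp [gradedGF, h]

/-- An injection preserving size and weight whose range contains every object of weight `r`
identifies the generating functions at weight `r`. -/
theorem gradedGF_eq_of_injective {α β : Type} [Graded α] [Graded β] (φ : α → β)
    (hφ : Function.Injective φ) (hs : ∀ a, Graded.size (φ a) = Graded.size a)
    (hw : ∀ a, Graded.weight (φ a) = Graded.weight a) (r : ℕ)
    (hr : ∀ b : β, Graded.weight b = r → ∃ a, φ a = b) : gradedGF β r = gradedGF α r := by
  ext n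
  have h : Graded.level β r n = φ '' Graded.level α r n := by
    ext b
    constructor
    · rintro ⟨h1, h2⟩
      obtain ⟨a, rfl⟩ := hr b h2
      exact ⟨a, ⟨(hs a).symm.trans h1, (hw a).symm.trans h2⟩, rfl⟩
    · rintro ⟨a, ⟨h1, h2⟩, rfl⟩
      exact ⟨(hs a).trans h1, (hw a).trans h2⟩
  simp only [gradedGF, PowerSeries.coeff_mk, h, Set.ncard_image_of_injective _ hφ]

/-! ### Involutions as self-maps of ℕ, and their blocks -/

/-- An involution of `{0, …, size - 1}`, extended by the identity to all of `ℕ`. -/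
@[ext]
structure Invol where
  size : ℕ
  toFun : ℕ → ℕ
  invol : ∀ i, toFun (toFun i) = i
  fixed : ∀ i, size ≤ i → toFun i = i

namespace Invol

theorem toFun_lt (g : Invol) {i : ℕ} (hi : i < g.size) : g.toFun i < g.size := by
  by_contra h
  have h1 := g.fixed _ (not_lt.mp h)
  rw [g.invol] at h1
  omega

/-- The interval of length `g.size` from `l` on is invariant under `f`, which acts on it as `g`. -/
def Block (f : ℕ → ℕ) (l : ℕ) (g : Invol) : Prop :=
  ∀ i < g.size, f (l + i) = l + g.toFun i

theorem Block.mem {f : ℕ → ℕ} {l : ℕ} {g : Invol} (h : Block f l g) {i : ℕ} (h1 : l ≤ i)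
    (h2 : i < l + g.size) : l ≤ f i ∧ f i < l + g.size := by
  obtain ⟨j, rfl⟩ := Nat.exists_eq_add_of_le h1
  have h3 := h j (by omega)
  have h4 := g.toFun_lt (i := j) (by omega)
  omega

theorem Block.unique {f : ℕ → ℕ} {l : ℕ} {g g' : Invol} (h : Block f l g) (h' : Block f l g')
    (hs : g.size = g'.size) : g = g' := by
  refine Invol.ext hs (funext fun i => ?_)
  rcases lt_or_ge i g.size with hi | hi
  · have h1 := h i hi
    have h2 := h' i (hs ▸ hi)
    omega
  · rw [g.fixed i hi, g'.fixed i (hs ▸ hi)]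

theorem Block.congr {f f' : ℕ → ℕ} {l : ℕ} {g : Invol} (h : Block f l g) (h' : Block f' l g)
    {i : ℕ} (h1 : l ≤ i) (h2 : i < l + g.size) : f i = f' i := by
  obtain ⟨j, rfl⟩ := Nat.exists_eq_add_of_le h1
  rw [h j (by omega), h' j (by omega)]

theorem exists_block (π : Invol) (l p : ℕ)
    (h : ∀ i, l ≤ i → i < l + p → l ≤ π.toFun i ∧ π.toFun i < l + p) :
    ∃ g : Invol, g.size = p ∧ Block π.toFun l g := by
  refine ⟨⟨p, fun i => if i < p then π.toFun (l + i) - l else i, fun i => ?_, fun i hi => ?_⟩,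
    rfl, fun i hi => ?_⟩
  · by_cases hi : i < p
    · have h1 := h (l + i) (by omega) (by omega)
      have h2 : π.toFun (l + i) - l < p := by omega
      simp only [hi, h2, if_true]
      rw [Nat.add_sub_cancel' h1.1, π.invol]
      omega
    · simp [hi]
  · simp only [not_lt.mpr hi, if_false]
  · have h1 := h (l + i) (by omega) (by change i < p at hi; omega)
    change i < p at hi
    simp only [hi, if_true]
    omega

/-- Let an involution act as `g` on an interval that it fixes pointwise. -/
def patch (f : ℕ → ℕ) (l : ℕ) (g : Invol) (i : ℕ) : ℕ :=
  if l ≤ i ∧ i < l + g.size then l + g.toFun (i - l) else f i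

theorem patch_of_lt {f : ℕ → ℕ} {l : ℕ} {g : Invol} {i : ℕ} (h : i < l) : patch f l g i = f i :=
  if_neg (by omega)

theorem patch_of_le {f : ℕ → ℕ} {l : ℕ} {g : Invol} {i : ℕ} (h : l + g.size ≤ i) :
    patch f l g i = f i :=
  if_neg (by omega)

theorem block_patch (f : ℕ → ℕ) (l : ℕ) (g : Invol) : Block (patch f l g) l g := by
  intro i hi
  rw [patch, if_pos (by omega), Nat.add_sub_cancel_left]

theorem Block.patch_of_lt {f : ℕ → ℕ} {k l : ℕ} {g h : Invol} (hb : Block f k g)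
    (hl : k + g.size ≤ l) : Block (patch f l h) k g := fun i hi => by
  rw [Invol.patch_of_lt (by omega), hb i hi]

/-- The interval is fixed pointwise by `f`, so its complement is stable under `f` and the two pieces
do not interact. -/
theorem patch_involutive {f : ℕ → ℕ} (hf : Function.Involutive f) {l : ℕ} {g : Invol}
    (h : ∀ i, l ≤ i → i < l + g.size → f i = i) : Function.Involutive (patch f l g) := by
  intro i
  by_cases hi : l ≤ i ∧ i < l + g.size
  · obtain ⟨j, rfl⟩ := Nat.exists_eq_add_of_le hi.1
    have hj : j < g.size := by omega
    rw [block_patch f l g j hj, block_patch f l g _ (g.toFun_lt hj), g.invol]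
  · have h1 : patch f l g i = f i := if_neg hi
    rw [h1]
    have h2 : ¬ (l ≤ f i ∧ f i < l + g.size) := fun h3 => by
      have h4 := h _ h3.1 h3.2
      rw [hf i] at h4
      rw [← h4] at h3
      exact hi h3
    rw [patch, if_neg h2, hf i]

/-! ### The four nonempty shapes and their construction -/

/-- `π` is `r` preceded by a fixed point. -/
structure IsFix (π r : Invol) : Prop where
  size_eq : π.size = 1 + r.size
  zero : π.toFun 0 = 0
  block : Block π.toFun 1 r

/-- `π` is `r` preceded by an arc over `g`. -/
structure IsArc (π g r : Invol) (c : ℕ) : Prop where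
  c_eq : c = g.size + 1
  size_eq : π.size = c + 1 + r.size
  zero : π.toFun 0 = c
  inner : Block π.toFun 1 g
  block : Block π.toFun (c + 1) r

/-- `π` is `r` preceded by two crossing arcs `(0, c)` and `(b, d)` that cut out intervals on which
`π` acts as `g`, as the reversal of `k` points, and as `h`. -/
structure IsCross (π g : Invol) (k : ℕ) (h r : Invol) (b c d : ℕ) : Prop where
  b_eq : b = g.size + 1
  c_eq : c = b + k + 1
  d_eq : d = c + h.size + 1
  size_eq : π.size = d + 1 + r.size
  zero : π.toFun 0 = c
  second : π.toFun b = d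
  inner : Block π.toFun 1 g
  middle : ∀ i, b < i → i < c → π.toFun i = b + c - i
  inner' : Block π.toFun (c + 1) h
  block : Block π.toFun (d + 1) r

/-- `π` is `r` preceded by three arcs `(0, c)`, `(b, e)`, `(d, f)`, each crossing the next,
that cut out intervals on which `π` acts as `g`, as the reversal of `j` points, as `h`,
as the reversal of `k` points, and as `u`. -/
structure IsChain (π g : Invol) (j : ℕ) (h : Invol) (k : ℕ) (u r : Invol) (b c d e f : ℕ) :
    Prop where
  b_eq : b = g.size + 1
  c_eq : c = b + j + 1
  d_eq : d = c + h.size + 1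
  e_eq : e = d + k + 1
  f_eq : f = e + u.size + 1
  size_eq : π.size = f + 1 + r.size
  zero : π.toFun 0 = c
  second : π.toFun b = e
  third : π.toFun d = f
  inner : Block π.toFun 1 g
  middle : ∀ i, b < i → i < c → π.toFun i = b + c - i
  inner' : Block π.toFun (c + 1) h
  middle' : ∀ i, d < i → i < e → π.toFun i = d + e - i
  inner'' : Block π.toFun (e + 1) u
  block : Block π.toFun (f + 1) r

theorem exists_isFix (r : Invol) : ∃ π, IsFix π r := by
  refine ⟨⟨1 + r.size, patch id 1 r, patch_involutive (fun _ => rfl) fun _ _ _ => rfl,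
    fun i hi => ?_⟩, rfl, ?_, block_patch _ _ _⟩
  · rw [patch_of_le hi]; rfl
  · change patch id 1 r 0 = 0
    rw [patch_of_lt (by omega), id]

/-- The bare arc is the transposition of 0 and `c`; the blocks are then patched into intervals that
it fixes pointwise. The crossing and the chain are built the same way from their arcs and reversed
runs. -/
theorem exists_isArc (g r : Invol) : ∃ π, IsArc π g r (g.size + 1) := by
  set c := g.size + 1 with hc
  let f : ℕ → ℕ := fun i => if i = 0 then c else if i = c then 0 else i
  have hv : ∀ i, i = 0 ∧ f i = c ∨ i = c ∧ f i = 0 ∨ (0 < i ∧ i ≠ c) ∧ f i = i := fun i => by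
    simp only [f]
    split_ifs <;> omega
  have hf : Function.Involutive f := fun i => by
    have h1 := hv (f i)
    rcases hv i with h2 | h2 | h2 <;> omega
  have hf' : ∀ i, 0 < i → i ≠ c → f i = i := fun i h1 h2 => by
    simp only [f]
    split_ifs <;> omega
  have h1 := patch_involutive hf (l := 1) (g := g) fun i _ _ => hf' i (by omega) (by omega)
  have h2 := patch_involutive h1 (l := c + 1) (g := r) fun i _ _ => by
    rw [patch_of_le (by omega), hf' i (by omega) (by omega)]
  refine ⟨⟨c + 1 + r.size, patch (patch f 1 g) (c + 1) r, h2, fun i hi => ?_⟩,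
    hc, rfl, ?_, ?_, block_patch _ _ _⟩
  · rw [patch_of_le (by omega), patch_of_le (by omega), hf' i (by omega) (by omega)]
  · change patch (patch f 1 g) (c + 1) r 0 = c
    rw [patch_of_lt (by omega), patch_of_lt (by omega)]
    simp [f]
  · exact (block_patch _ _ _).patch_of_lt (by omega)

theorem exists_isCross (g : Invol) (k : ℕ) (h r : Invol) :
    ∃ π, IsCross π g k h r (g.size + 1) (g.size + 1 + k + 1)
      (g.size + 1 + k + 1 + h.size + 1) := by
  set b := g.size + 1 with hb
  set c := b + k + 1 with hc
  set d := c + h.size + 1 with hd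
  let f : ℕ → ℕ := fun i => if i = 0 then c else if i = c then 0 else if i = b then d else
    if i = d then b else if b < i ∧ i < c then b + c - i else i
  -- A table of positions with their values: involutivity becomes linear arithmetic, case by case.
  have hv : ∀ i, i = 0 ∧ f i = c ∨ i = c ∧ f i = 0 ∨ i = b ∧ f i = d ∨ i = d ∧ f i = b ∨
      (b < i ∧ i < c) ∧ f i = b + c - i ∨ (0 < i ∧ i < b ∨ c < i ∧ i ≠ d) ∧ f i = i := fun i => by
    simp only [f]
    split_ifs <;> omega
  have hf : Function.Involutive f := fun i => by
    have h1 := hv (f i)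
    rcases hv i with h2 | h2 | h2 | h2 | h2 | h2 <;> omega
  have hf' : ∀ i, 0 < i → (i < b ∨ c < i) → i ≠ d → f i = i := fun i h1 h2 h3 => by
    have := hv i
    omega
  have h1 := patch_involutive hf (l := 1) (g := g) fun i _ _ =>
    hf' i (by omega) (by omega) (by omega)
  have h2 := patch_involutive h1 (l := c + 1) (g := h) fun i _ _ => by
    rw [patch_of_le (by omega), hf' i (by omega) (by omega) (by omega)]
  have h3 := patch_involutive h2 (l := d + 1) (g := r) fun i _ _ => by
    rw [patch_of_le (by omega), patch_of_le (by omega), hf' i (by omega) (by omega) (by omega)]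
  refine ⟨⟨d + 1 + r.size, patch (patch (patch f 1 g) (c + 1) h) (d + 1) r, h3, fun i hi => ?_⟩,
    hb, hc, hd, rfl, ?_, ?_, ?_, fun i hi hi' => ?_, ?_, block_patch _ _ _⟩
  · rw [patch_of_le (by omega), patch_of_le (by omega), patch_of_le (by omega),
      hf' i (by omega) (by omega) (by omega)]
  · change patch (patch (patch f 1 g) (c + 1) h) (d + 1) r 0 = c
    rw [patch_of_lt (by omega), patch_of_lt (by omega), patch_of_lt (by omega)]
    have := hv 0
    omega
  · change patch (patch (patch f 1 g) (c + 1) h) (d + 1) r b = d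
    rw [patch_of_lt (by omega), patch_of_lt (by omega), patch_of_le (by omega)]
    have := hv b
    omega
  · exact ((block_patch _ _ _).patch_of_lt (by omega)).patch_of_lt (by omega)
  · change patch (patch (patch f 1 g) (c + 1) h) (d + 1) r i = b + c - i
    rw [patch_of_lt (by omega), patch_of_lt (by omega), patch_of_le (by omega)]
    have := hv i
    omega
  · exact (block_patch _ _ _).patch_of_lt (by omega)

theorem exists_isChain (g : Invol) (j : ℕ) (h : Invol) (k : ℕ) (u r : Invol) :
    ∃ π b c d e f, IsChain π g j h k u r b c d e f := by
  obtain ⟨b, hb⟩ : ∃ b, b = g.size + 1 := ⟨_, rfl⟩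
  obtain ⟨c, hc⟩ : ∃ c, c = b + j + 1 := ⟨_, rfl⟩
  obtain ⟨d, hd⟩ : ∃ d, d = c + h.size + 1 := ⟨_, rfl⟩
  obtain ⟨e, he⟩ : ∃ e, e = d + k + 1 := ⟨_, rfl⟩
  obtain ⟨f, hf⟩ : ∃ f, f = e + u.size + 1 := ⟨_, rfl⟩
  let p : ℕ → ℕ := fun i => if i = 0 then c else if i = c then 0 else if i = b then e else
    if i = e then b else if i = d then f else if i = f then d else
    if b < i ∧ i < c then b + c - i else if d < i ∧ i < e then d + e - i else i
  have hv : ∀ i, i = 0 ∧ p i = c ∨ i = c ∧ p i = 0 ∨ i = b ∧ p i = e ∨ i = e ∧ p i = b ∨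
      i = d ∧ p i = f ∨ i = f ∧ p i = d ∨ (b < i ∧ i < c) ∧ p i = b + c - i ∨
      (d < i ∧ i < e) ∧ p i = d + e - i ∨
      (0 < i ∧ i < b ∨ c < i ∧ i < d ∨ e < i ∧ i ≠ f) ∧ p i = i := fun i => by
    by_cases h0 : i = 0
    · exact Or.inl ⟨h0, by simp only [p, if_pos h0]⟩
    by_cases h1 : i = c
    · exact Or.inr (Or.inl ⟨h1, by simp only [p, if_neg h0, if_pos h1]⟩)
    by_cases h2 : i = b
    · exact Or.inr (Or.inr (Or.inl ⟨h2, by simp only [p, if_neg h0, if_neg h1, if_pos h2]⟩))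
    by_cases h3 : i = e
    · exact Or.inr (Or.inr (Or.inr (Or.inl ⟨h3, by simp only [p, if_neg h0, if_neg h1, if_neg h2, if_pos h3]⟩)))
    by_cases h4 : i = d
    · exact Or.inr (Or.inr (Or.inr (Or.inr (Or.inl ⟨h4, by simp only [p, if_neg h0, if_neg h1, if_neg h2, if_neg h3, if_pos h4]⟩))))
    by_cases h5 : i = f
    · exact Or.inr (Or.inr (Or.inr (Or.inr (Or.inr (Or.inl ⟨h5, by simp only [p, if_neg h0, if_neg h1, if_neg h2, if_neg h3, if_neg h4, if_pos h5]⟩)))))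
    by_cases h6 : b < i ∧ i < c
    · exact Or.inr (Or.inr (Or.inr (Or.inr (Or.inr (Or.inr (Or.inl ⟨h6, by simp only [p, if_neg h0, if_neg h1, if_neg h2, if_neg h3, if_neg h4, if_neg h5, if_pos h6]⟩))))))
    by_cases h7 : d < i ∧ i < e
    · exact Or.inr (Or.inr (Or.inr (Or.inr (Or.inr (Or.inr (Or.inr (Or.inl ⟨h7, by simp only [p, if_neg h0, if_neg h1, if_neg h2, if_neg h3, if_neg h4, if_neg h5, if_neg h6, if_pos h7]⟩)))))))
    · exact Or.inr (Or.inr (Or.inr (Or.inr (Or.inr (Or.inr (Or.inr (Or.inr ⟨by omega, by simp only [p, if_neg h0, if_neg h1, if_neg h2, if_neg h3, if_neg h4, if_neg h5, if_neg h6, if_neg h7]⟩)))))))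
  have hp : Function.Involutive p := fun i => by
    have h1 := hv (p i)
    rcases hv i with h2 | h2 | h2 | h2 | h2 | h2 | h2 | h2 | h2 <;> omega
  have hp' : ∀ i, 0 < i → (i < b ∨ c < i ∧ i < d ∨ e < i) → i ≠ f → p i = i := fun i h1 h2 h3 => by
    have := hv i
    omega
  have h1 := patch_involutive hp (l := 1) (g := g) fun i _ _ =>
    hp' i (by omega) (by omega) (by omega)
  have h2 := patch_involutive h1 (l := c + 1) (g := h) fun i _ _ => by
    rw [patch_of_le (by omega), hp' i (by omega) (by omega) (by omega)]
  have h3 := patch_involutive h2 (l := e + 1) (g := u) fun i _ _ => by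
    rw [patch_of_le (by omega), patch_of_le (by omega), hp' i (by omega) (by omega) (by omega)]
  have h4 := patch_involutive h3 (l := f + 1) (g := r) fun i _ _ => by
    rw [patch_of_le (by omega), patch_of_le (by omega), patch_of_le (by omega),
      hp' i (by omega) (by omega) (by omega)]
  obtain ⟨q, hq⟩ : ∃ q, q = patch (patch (patch (patch p 1 g) (c + 1) h) (e + 1) u) (f + 1) r :=
    ⟨_, rfl⟩
  rw [← hq] at h4
  refine ⟨⟨f + 1 + r.size, q, h4, fun i hi => ?_⟩, b, c, d, e, f,
    hb, hc, hd, he, hf, rfl, ?_, ?_, ?_, ?_, fun i hi hi' => ?_, ?_, fun i hi hi' => ?_, ?_, ?_⟩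
  · rw [hq, patch_of_le (by omega), patch_of_le (by omega), patch_of_le (by omega),
      patch_of_le (by omega), hp' i (by omega) (by omega) (by omega)]
  · change q 0 = c
    rw [hq, patch_of_lt (by omega), patch_of_lt (by omega), patch_of_lt (by omega),
      patch_of_lt (by omega)]
    have := hv 0
    omega
  · change q b = e
    rw [hq, patch_of_lt (by omega), patch_of_lt (by omega), patch_of_lt (by omega),
      patch_of_le (by omega)]
    have := hv b
    omega
  · change q d = f
    rw [hq, patch_of_lt (by omega), patch_of_lt (by omega), patch_of_le (by omega),
      patch_of_le (by omega)]
    have := hv d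
    omega
  · change Block q _ _
    rw [hq]
    exact (((block_patch _ _ _).patch_of_lt (by omega)).patch_of_lt (by omega)).patch_of_lt
      (by omega)
  · change q i = b + c - i
    rw [hq, patch_of_lt (by omega), patch_of_lt (by omega), patch_of_lt (by omega),
      patch_of_le (by omega)]
    have := hv i
    omega
  · change Block q _ _
    rw [hq]
    exact ((block_patch _ _ _).patch_of_lt (by omega)).patch_of_lt (by omega)
  · change q i = d + e - i
    rw [hq, patch_of_lt (by omega), patch_of_lt (by omega), patch_of_le (by omega),
      patch_of_le (by omega)]
    have := hv i
    omega
  · change Block q _ _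
    rw [hq]
    exact (block_patch _ _ _).patch_of_lt (by omega)
  · change Block q _ _
    rw [hq]
    exact block_patch _ _ _

end Invol

namespace Invol

/-! ### Occurrences of 3412 and their additivity over the shapes -/

/-- The positions `a < b < c < d` carry an occurrence of `3412` in `f`. -/
def Occ (f : ℕ → ℕ) (a b c d : ℕ) : Prop :=
  a < b ∧ b < c ∧ c < d ∧ f c < f d ∧ f d < f a ∧ f a < f b

/-- The occurrences of `3412` in `f`. -/
def occSet (f : ℕ → ℕ) : Set (ℕ × ℕ × ℕ × ℕ) :=
  {q | Occ f q.1 q.2.1 q.2.2.1 q.2.2.2}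

/-- The number of occurrences of `3412` in an involution. -/
noncomputable def occ (π : Invol) : ℕ :=
  (occSet π.toFun).ncard

/-- Translation of quadruples of positions. -/
def shift (l : ℕ) (q : ℕ × ℕ × ℕ × ℕ) : ℕ × ℕ × ℕ × ℕ :=
  (l + q.1, l + q.2.1, l + q.2.2.1, l + q.2.2.2)

theorem shift_injective (l : ℕ) : Function.Injective (shift l) := by
  rintro ⟨a, b, c, d⟩ ⟨a', b', c', d'⟩ h
  simp only [shift, Prod.mk.injEq] at h ⊢
  omega

/-- A position past the size is fixed and exceeds the values at all earlier positions, whereas the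
last value of an occurrence lies below the first. -/
theorem lt_size_of_occ {π : Invol} {a b c d : ℕ} (h : Occ π.toFun a b c d) : d < π.size := by
  obtain ⟨h1, h2, h3, h4, h5, h6⟩ := h
  by_contra h7
  have h8 := π.fixed d (by omega)
  rcases lt_or_ge a π.size with h9 | h9
  · have := π.toFun_lt h9
    omega
  · have := π.fixed a h9
    omega

theorem finite_occSet (π : Invol) : (occSet π.toFun).Finite := by
  refine ((Set.finite_Iio π.size).prod ((Set.finite_Iio π.size).prod
    ((Set.finite_Iio π.size).prod (Set.finite_Iio π.size)))).subset ?_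
  rintro ⟨a, b, c, d⟩ h
  have h1 : d < π.size := lt_size_of_occ h
  obtain ⟨h2, h3, h4, -⟩ : Occ π.toFun a b c d := h
  simp only [Set.mem_prod, Set.mem_Iio]
  omega

/-- The occurrences inside a block are those of the involution on it. -/
theorem Block.occ_mem {f : ℕ → ℕ} {l : ℕ} {g : Invol} (hb : Block f l g) {a b c d : ℕ}
    (h : Occ f a b c d) (h1 : l ≤ a) (h2 : d < l + g.size) :
    (a, b, c, d) ∈ shift l '' occSet g.toFun := by
  obtain ⟨h3, h4, h5, h6⟩ := h
  obtain ⟨a, rfl⟩ := Nat.exists_eq_add_of_le h1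
  obtain ⟨b, rfl⟩ := Nat.exists_eq_add_of_le (show l ≤ b by omega)
  obtain ⟨c, rfl⟩ := Nat.exists_eq_add_of_le (show l ≤ c by omega)
  obtain ⟨d, rfl⟩ := Nat.exists_eq_add_of_le (show l ≤ d by omega)
  rw [hb a (by omega), hb b (by omega), hb c (by omega), hb d (by omega)] at h6
  refine ⟨(a, b, c, d), ?_, rfl⟩
  simp only [occSet, Occ, Set.mem_ofPred_eq]
  omega

theorem Block.shift_mem {f : ℕ → ℕ} {l : ℕ} {g : Invol} (hb : Block f l g) :
    ∀ q ∈ shift l '' occSet g.toFun, q ∈ occSet f ∧ l ≤ q.1 ∧ q.2.2.2 < l + g.size := by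
  rintro _ ⟨⟨a, b, c, d⟩, h, rfl⟩
  have h1 : d < g.size := lt_size_of_occ h
  simp only [occSet, Occ, Set.mem_ofPred_eq, shift] at h ⊢
  rw [hb a (by omega), hb b (by omega), hb c (by omega), hb d (by omega)]
  omega

theorem ncard_shift (l : ℕ) (g : Invol) : (shift l '' occSet g.toFun).ncard = g.occ :=
  Set.ncard_image_of_injective _ (shift_injective l)

theorem finite_shift (l : ℕ) (g : Invol) : (shift l '' occSet g.toFun).Finite :=
  (finite_occSet g).image _

variable {π g h u r : Invol} {j k b c d e f : ℕ}

theorem Block.above {n l : ℕ} (hs : π.size = l + r.size) (hb : Block π.toFun l r) (hn : l ≤ n) :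
    l ≤ π.toFun n := by
  rcases lt_or_ge n (l + r.size) with h | h
  · exact (hb.mem hn h).1
  · rw [π.fixed n (by omega)]
    exact hn

/-- Locates a position and its value together. The analogues for the other shapes reduce the search
for occurrences to finitely many cases of linear arithmetic. -/
theorem IsFix.loc (H : IsFix π r) (i : ℕ) :
    i = 0 ∧ π.toFun i = 0 ∨ 1 ≤ i ∧ 1 ≤ π.toFun i := by
  rcases Nat.eq_zero_or_pos i with rfl | hi
  · exact Or.inl ⟨rfl, H.zero⟩
  · exact Or.inr ⟨hi, H.block.above H.size_eq hi⟩

theorem IsArc.loc (H : IsArc π g r c) (i : ℕ) :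
    i = 0 ∧ π.toFun i = c ∨ (1 ≤ i ∧ i < c) ∧ 1 ≤ π.toFun i ∧ π.toFun i < c ∨
      i = c ∧ π.toFun i = 0 ∨ c < i ∧ c < π.toFun i := by
  have h1 := H.c_eq
  have h2 : π.toFun c = 0 := by rw [← H.zero, π.invol]
  rcases Nat.eq_zero_or_pos i with rfl | hi
  · exact Or.inl ⟨rfl, H.zero⟩
  rcases lt_trichotomy i c with h3 | rfl | h3
  · have := H.inner.mem hi (by omega)
    omega
  · omega
  · have := H.block.above H.size_eq h3
    omega

theorem IsCross.loc (H : IsCross π g k h r b c d) (i : ℕ) :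
    i = 0 ∧ π.toFun i = c ∨ (1 ≤ i ∧ i < b) ∧ 1 ≤ π.toFun i ∧ π.toFun i < b ∨
      i = b ∧ π.toFun i = d ∨ (b < i ∧ i < c) ∧ π.toFun i + i = b + c ∨
      i = c ∧ π.toFun i = 0 ∨ (c < i ∧ i < d) ∧ c < π.toFun i ∧ π.toFun i < d ∨
      i = d ∧ π.toFun i = b ∨ d < i ∧ d < π.toFun i := by
  have h1 := H.b_eq
  have h2 := H.c_eq
  have h3 := H.d_eq
  have h4 : π.toFun c = 0 := by rw [← H.zero, π.invol]
  have h5 : π.toFun d = b := by rw [← H.second, π.invol]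
  rcases Nat.eq_zero_or_pos i with rfl | hi
  · exact Or.inl ⟨rfl, H.zero⟩
  rcases lt_trichotomy i b with hb' | rfl | hb'
  · exact Or.inr (Or.inl ⟨⟨hi, hb'⟩, (H.inner.mem hi (by omega)).1, (H.inner.mem hi (by omega)).2.trans_le (by omega)⟩)
  · exact Or.inr (Or.inr (Or.inl ⟨rfl, H.second⟩))
  rcases lt_trichotomy i c with hc' | rfl | hc'
  · exact Or.inr (Or.inr (Or.inr (Or.inl ⟨⟨hb', hc'⟩, (by have := H.middle i hb' hc'; omega)⟩)))
  · exact Or.inr (Or.inr (Or.inr (Or.inr (Or.inl ⟨rfl, h4⟩))))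
  rcases lt_trichotomy i d with hd' | rfl | hd'
  · exact Or.inr (Or.inr (Or.inr (Or.inr (Or.inr (Or.inl ⟨⟨hc', hd'⟩, (H.inner'.mem hc' (by omega)).1, (H.inner'.mem hc' (by omega)).2.trans_le (by omega)⟩)))))
  · exact Or.inr (Or.inr (Or.inr (Or.inr (Or.inr (Or.inr (Or.inl ⟨rfl, h5⟩))))))
  exact Or.inr (Or.inr (Or.inr (Or.inr (Or.inr (Or.inr (Or.inr (⟨hd', H.block.above H.size_eq hd'⟩)))))))

theorem IsChain.loc (H : IsChain π g j h k u r b c d e f) (i : ℕ) :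
    i = 0 ∧ π.toFun i = c ∨ (1 ≤ i ∧ i < b) ∧ 1 ≤ π.toFun i ∧ π.toFun i < b ∨
      i = b ∧ π.toFun i = e ∨ (b < i ∧ i < c) ∧ π.toFun i + i = b + c ∨
      i = c ∧ π.toFun i = 0 ∨ (c < i ∧ i < d) ∧ c < π.toFun i ∧ π.toFun i < d ∨
      i = d ∧ π.toFun i = f ∨ (d < i ∧ i < e) ∧ π.toFun i + i = d + e ∨
      i = e ∧ π.toFun i = b ∨ (e < i ∧ i < f) ∧ e < π.toFun i ∧ π.toFun i < f ∨
      i = f ∧ π.toFun i = d ∨ f < i ∧ f < π.toFun i := by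
  have h1 := H.b_eq
  have h2 := H.c_eq
  have h3 := H.d_eq
  have h3' := H.e_eq
  have h3'' := H.f_eq
  have h4 : π.toFun c = 0 := by rw [← H.zero, π.invol]
  have h5 : π.toFun e = b := by rw [← H.second, π.invol]
  have h5' : π.toFun f = d := by rw [← H.third, π.invol]
  rcases Nat.eq_zero_or_pos i with rfl | hi
  · exact Or.inl ⟨rfl, H.zero⟩
  rcases lt_trichotomy i b with hb' | rfl | hb'
  · exact Or.inr (Or.inl ⟨⟨hi, hb'⟩, (H.inner.mem hi (by omega)).1, (H.inner.mem hi (by omega)).2.trans_le (by omega)⟩)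
  · exact Or.inr (Or.inr (Or.inl ⟨rfl, H.second⟩))
  rcases lt_trichotomy i c with hc' | rfl | hc'
  · exact Or.inr (Or.inr (Or.inr (Or.inl ⟨⟨hb', hc'⟩, (by have := H.middle i hb' hc'; omega)⟩)))
  · exact Or.inr (Or.inr (Or.inr (Or.inr (Or.inl ⟨rfl, h4⟩))))
  rcases lt_trichotomy i d with hd' | rfl | hd'
  · exact Or.inr (Or.inr (Or.inr (Or.inr (Or.inr (Or.inl ⟨⟨hc', hd'⟩, (H.inner'.mem hc' (by omega)).1, (H.inner'.mem hc' (by omega)).2.trans_le (by omega)⟩)))))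
  · exact Or.inr (Or.inr (Or.inr (Or.inr (Or.inr (Or.inr (Or.inl ⟨rfl, H.third⟩))))))
  rcases lt_trichotomy i e with he' | rfl | he'
  · exact Or.inr (Or.inr (Or.inr (Or.inr (Or.inr (Or.inr (Or.inr (Or.inl ⟨⟨hd', he'⟩, (by have := H.middle' i hd' he'; omega)⟩)))))))
  · exact Or.inr (Or.inr (Or.inr (Or.inr (Or.inr (Or.inr (Or.inr (Or.inr (Or.inl ⟨rfl, h5⟩))))))))
  rcases lt_trichotomy i f with hf' | rfl | hf'
  · exact Or.inr (Or.inr (Or.inr (Or.inr (Or.inr (Or.inr (Or.inr (Or.inr (Or.inr (Or.inl ⟨⟨he', hf'⟩, (H.inner''.mem he' (by omega)).1, (H.inner''.mem he' (by omega)).2.trans_le (by omega)⟩)))))))))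
  · exact Or.inr (Or.inr (Or.inr (Or.inr (Or.inr (Or.inr (Or.inr (Or.inr (Or.inr (Or.inr (Or.inl ⟨rfl, h5'⟩))))))))))
  exact Or.inr (Or.inr (Or.inr (Or.inr (Or.inr (Or.inr (Or.inr (Or.inr (Or.inr (Or.inr (Or.inr (⟨hf', H.block.above H.size_eq hf'⟩)))))))))))

theorem IsFix.occ_eq (H : IsFix π r) : π.occ = r.occ := by
  have h1 : occSet π.toFun = shift 1 '' occSet r.toFun := by
    refine Set.Subset.antisymm ?_ fun q hq => (H.block.shift_mem q hq).1
    rintro ⟨x, y, z, w⟩ (hq : Occ π.toFun x y z w)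
    have hw := H.size_eq ▸ lt_size_of_occ hq
    refine H.block.occ_mem hq ?_ hw
    have hx := H.loc x
    obtain ⟨-, -, -, -, h5, -⟩ := hq
    omega
  rw [occ, h1, ncard_shift]

theorem IsArc.occ_eq (H : IsArc π g r c) : π.occ = g.occ + r.occ := by
  have hc := H.c_eq
  have h1 : occSet π.toFun = shift 1 '' occSet g.toFun ∪ shift (c + 1) '' occSet r.toFun := by
    refine Set.Subset.antisymm ?_ (Set.union_subset (fun q hq => (H.inner.shift_mem q hq).1)
      fun q hq => (H.block.shift_mem q hq).1)
    rintro ⟨x, y, z, w⟩ (hq : Occ π.toFun x y z w)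
    have hw := H.size_eq ▸ lt_size_of_occ hq
    have key : 1 ≤ x ∧ w < c ∨ c < x := by
      obtain ⟨h1, h2, h3, h4, h5, h6⟩ := hq
      rcases H.loc x with hx | hx | hx | hx <;> rcases H.loc y with hy | hy | hy | hy <;>
        first
        | omega
        | have hz := H.loc z
          have hw := H.loc w
          omega
    rcases key with h2 | h2
    · exact Or.inl (H.inner.occ_mem hq h2.1 (by omega))
    · exact Or.inr (H.block.occ_mem hq h2 hw)
  have hd : Disjoint (shift 1 '' occSet g.toFun) (shift (c + 1) '' occSet r.toFun) := by
    rw [Set.disjoint_left]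
    intro q h2 h3
    obtain ⟨⟨h4, h5, h6, -⟩, h7, h8⟩ := H.inner.shift_mem q h2
    obtain ⟨-, h9, -⟩ := H.block.shift_mem q h3
    omega
  rw [occ, h1, Set.ncard_union_eq hd (finite_shift _ _) (finite_shift _ _), ncard_shift,
    ncard_shift]

/-- An occurrence either stays in one block or is the crossing itself: the reversed middle is
decreasing and nested under both arcs, so it takes part in none. -/
theorem IsCross.occ_eq (H : IsCross π g k h r b c d) : π.occ = 1 + g.occ + h.occ + r.occ := by
  have hb := H.b_eq
  have hc := H.c_eq
  have hd := H.d_eq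
  have h0 : (0, b, c, d) ∈ occSet π.toFun := by
    have h1 : π.toFun c = 0 := by rw [← H.zero, π.invol]
    have h2 : π.toFun d = b := by rw [← H.second, π.invol]
    have h3 := H.zero
    have h4 := H.second
    simp only [occSet, Occ, Set.mem_ofPred_eq]
    omega
  have h1 : occSet π.toFun = {(0, b, c, d)} ∪ shift 1 '' occSet g.toFun ∪
      shift (c + 1) '' occSet h.toFun ∪ shift (d + 1) '' occSet r.toFun := by
    refine Set.Subset.antisymm ?_ (Set.union_subset (Set.union_subset (Set.union_subset
      (Set.singleton_subset_iff.mpr h0) (fun q hq => (H.inner.shift_mem q hq).1))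
      fun q hq => (H.inner'.shift_mem q hq).1) fun q hq => (H.block.shift_mem q hq).1)
    rintro ⟨x, y, z, w⟩ (hq : Occ π.toFun x y z w)
    have hw := H.size_eq ▸ lt_size_of_occ hq
    have key : (x = 0 ∧ y = b ∧ z = c ∧ w = d) ∨ (1 ≤ x ∧ w < b) ∨ (c < x ∧ w < d) ∨ d < x := by
      obtain ⟨h1, h2, h3, h4, h5, h6⟩ := hq
      rcases H.loc x with hx | hx | hx | hx | hx | hx | hx | hx <;>
        rcases H.loc y with hy | hy | hy | hy | hy | hy | hy | hy <;> try omega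
      all_goals
        rcases H.loc z with hz | hz | hz | hz | hz | hz | hz | hz <;> try omega
      all_goals
        rcases H.loc w with hw | hw | hw | hw | hw | hw | hw | hw <;> omega
    rcases key with ⟨rfl, rfl, rfl, rfl⟩ | h2 | h2 | h2
    · exact Or.inl (Or.inl (Or.inl rfl))
    · exact Or.inl (Or.inl (Or.inr (H.inner.occ_mem hq h2.1 (by omega))))
    · exact Or.inl (Or.inr (H.inner'.occ_mem hq h2.1 (by omega)))
    · exact Or.inr (H.block.occ_mem hq h2 hw)
  have hd1 : Disjoint {(0, b, c, d)} (shift 1 '' occSet g.toFun) := by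
    rw [Set.disjoint_left]
    rintro _ rfl h3
    have := H.inner.shift_mem _ h3
    omega
  have hd2 : Disjoint ({(0, b, c, d)} ∪ shift 1 '' occSet g.toFun)
      (shift (c + 1) '' occSet h.toFun) := by
    rw [Set.disjoint_left]
    rintro q h2 h3
    obtain ⟨-, h9, -⟩ := H.inner'.shift_mem q h3
    rcases h2 with rfl | h2
    · simp at h9
    · obtain ⟨⟨h4, h5, h6, -⟩, h7, h8⟩ := H.inner.shift_mem q h2
      omega
  have hd3 : Disjoint ({(0, b, c, d)} ∪ shift 1 '' occSet g.toFun ∪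
      shift (c + 1) '' occSet h.toFun) (shift (d + 1) '' occSet r.toFun) := by
    rw [Set.disjoint_left]
    rintro q h2 h3
    obtain ⟨-, h9, -⟩ := H.block.shift_mem q h3
    rcases h2 with (rfl | h2) | h2
    · simp at h9
    · obtain ⟨⟨h4, h5, h6, -⟩, h7, h8⟩ := H.inner.shift_mem q h2
      omega
    · obtain ⟨⟨h4, h5, h6, -⟩, h7, h8⟩ := H.inner'.shift_mem q h2
      omega
  rw [occ, h1, Set.ncard_union_eq hd3 (((Set.finite_singleton _).union (finite_shift _ _)).union
    (finite_shift _ _)) (finite_shift _ _), Set.ncard_union_eq hd2 ((Set.finite_singleton _).union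
    (finite_shift _ _)) (finite_shift _ _), Set.ncard_union_eq hd1 (Set.finite_singleton _)
    (finite_shift _ _), Set.ncard_singleton, ncard_shift, ncard_shift, ncard_shift]

-- The first and third arcs are disjoint, so the chain has two crossings only; anything else must
-- stay in one block.
set_option maxHeartbeats 1000000 in
theorem IsChain.occ_cases (H : IsChain π g j h k u r b c d e f) {x y z w : ℕ}
    (hq : Occ π.toFun x y z w) :
    (x = 0 ∧ y = b ∧ z = c ∧ w = e) ∨ (x = b ∧ y = d ∧ z = e ∧ w = f) ∨
      (1 ≤ x ∧ w < b) ∨ (c < x ∧ w < d) ∨ (e < x ∧ w < f) ∨ f < x := by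
  have hb : 0 < b := H.b_eq ▸ Nat.succ_pos _
  have hc : b < c := by have := H.c_eq; omega
  have hd : c < d := by have := H.d_eq; omega
  have he : d < e := by have := H.e_eq; omega
  have hf : e < f := by have := H.f_eq; omega
  obtain ⟨h1, h2, h3, h4, h5, h6⟩ := hq
  rcases H.loc x with hx | hx | hx | hx | hx | hx | hx | hx | hx | hx | hx | hx <;>
    rcases H.loc y with hy | hy | hy | hy | hy | hy | hy | hy | hy | hy | hy | hy <;>
    try (exfalso; omega)
  all_goals
    rcases H.loc z with hz | hz | hz | hz | hz | hz | hz | hz | hz | hz | hz | hz <;>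
    try (exfalso; omega)
  all_goals
    rcases H.loc w with hw | hw | hw | hw | hw | hw | hw | hw | hw | hw | hw | hw <;>
    first
    | (exfalso; omega)
    | omega

theorem IsChain.occ_eq (H : IsChain π g j h k u r b c d e f) :
    π.occ = 2 + g.occ + h.occ + u.occ + r.occ := by
  have hb := H.b_eq
  have hc := H.c_eq
  have hd := H.d_eq
  have he := H.e_eq
  have hf := H.f_eq
  have h1 : π.toFun c = 0 := by rw [← H.zero, π.invol]
  have h2 : π.toFun e = b := by rw [← H.second, π.invol]
  have h2' : π.toFun f = d := by rw [← H.third, π.invol]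
  have h3 := H.zero
  have h4 := H.second
  have h4' := H.third
  have h0 : (0, b, c, e) ∈ occSet π.toFun := by
    simp only [occSet, Occ, Set.mem_ofPred_eq]
    omega
  have h0' : (b, d, e, f) ∈ occSet π.toFun := by
    simp only [occSet, Occ, Set.mem_ofPred_eq]
    omega
  have hS : ({(0, b, c, e), (b, d, e, f)} : Set (ℕ × ℕ × ℕ × ℕ)).Finite := Set.toFinite _
  have h1 : occSet π.toFun = {(0, b, c, e), (b, d, e, f)} ∪ shift 1 '' occSet g.toFun ∪
      shift (c + 1) '' occSet h.toFun ∪ shift (e + 1) '' occSet u.toFun ∪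
      shift (f + 1) '' occSet r.toFun := by
    refine Set.Subset.antisymm ?_ (Set.union_subset (Set.union_subset (Set.union_subset
      (Set.union_subset (Set.insert_subset h0 (Set.singleton_subset_iff.mpr h0'))
      fun q hq => (H.inner.shift_mem q hq).1) fun q hq => (H.inner'.shift_mem q hq).1)
      fun q hq => (H.inner''.shift_mem q hq).1) fun q hq => (H.block.shift_mem q hq).1)
    rintro ⟨x, y, z, w⟩ (hq : Occ π.toFun x y z w)
    have hw : w < f + 1 + r.size := H.size_eq ▸ lt_size_of_occ hq
    have key := H.occ_cases hq
    rcases key with ⟨rfl, rfl, rfl, rfl⟩ | ⟨rfl, rfl, rfl, rfl⟩ | h2 | h2 | h2 | h2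
    · exact Or.inl (Or.inl (Or.inl (Or.inl (Or.inl rfl))))
    · exact Or.inl (Or.inl (Or.inl (Or.inl (Or.inr rfl))))
    · exact Or.inl (Or.inl (Or.inl (Or.inr (H.inner.occ_mem hq h2.1 (by omega)))))
    · exact Or.inl (Or.inl (Or.inr (H.inner'.occ_mem hq h2.1 (by omega))))
    · exact Or.inl (Or.inr (H.inner''.occ_mem hq h2.1 (by omega)))
    · exact Or.inr (H.block.occ_mem hq h2 hw)
  have hb1 := H.inner.shift_mem
  have hb2 := H.inner'.shift_mem
  have hb3 := H.inner''.shift_mem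
  have hb4 := H.block.shift_mem
  have hd1 : Disjoint {(0, b, c, e), (b, d, e, f)} (shift 1 '' occSet g.toFun) := by
    rw [Set.disjoint_left]
    rintro _ (rfl | rfl) h3 <;> have := hb1 _ h3 <;> dsimp only at this <;> omega
  have hd2 : Disjoint ({(0, b, c, e), (b, d, e, f)} ∪ shift 1 '' occSet g.toFun)
      (shift (c + 1) '' occSet h.toFun) := by
    rw [Set.disjoint_left]
    rintro q h2 h3
    obtain ⟨-, h9, -⟩ := hb2 q h3
    rcases h2 with (rfl | rfl) | h2
    · dsimp only at h9; omega
    · dsimp only at h9; omega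
    · obtain ⟨⟨h4, h5, h6, -⟩, h7, h8⟩ := hb1 q h2
      omega
  have hd3 : Disjoint ({(0, b, c, e), (b, d, e, f)} ∪ shift 1 '' occSet g.toFun ∪
      shift (c + 1) '' occSet h.toFun) (shift (e + 1) '' occSet u.toFun) := by
    rw [Set.disjoint_left]
    rintro q h2 h3
    obtain ⟨-, h9, -⟩ := hb3 q h3
    rcases h2 with ((rfl | rfl) | h2) | h2
    · dsimp only at h9; omega
    · dsimp only at h9; omega
    · obtain ⟨⟨h4, h5, h6, -⟩, h7, h8⟩ := hb1 q h2
      omega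
    · obtain ⟨⟨h4, h5, h6, -⟩, h7, h8⟩ := hb2 q h2
      omega
  have hd4 : Disjoint ({(0, b, c, e), (b, d, e, f)} ∪ shift 1 '' occSet g.toFun ∪
      shift (c + 1) '' occSet h.toFun ∪ shift (e + 1) '' occSet u.toFun)
      (shift (f + 1) '' occSet r.toFun) := by
    rw [Set.disjoint_left]
    rintro q h2 h3
    obtain ⟨-, h9, -⟩ := hb4 q h3
    rcases h2 with (((rfl | rfl) | h2) | h2) | h2
    · dsimp only at h9; omega
    · dsimp only at h9; omega
    · obtain ⟨⟨h4, h5, h6, -⟩, h7, h8⟩ := hb1 q h2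
      omega
    · obtain ⟨⟨h4, h5, h6, -⟩, h7, h8⟩ := hb2 q h2
      omega
    · obtain ⟨⟨h4, h5, h6, -⟩, h7, h8⟩ := hb3 q h2
      omega
  have hp : ({(0, b, c, e), (b, d, e, f)} : Set (ℕ × ℕ × ℕ × ℕ)).ncard = 2 :=
    Set.ncard_pair fun h => by
      simp only [Prod.mk.injEq] at h
      omega
  rw [occ, h1, Set.ncard_union_eq hd4 (((hS.union (finite_shift _ _)).union
    (finite_shift _ _)).union (finite_shift _ _)) (finite_shift _ _),
    Set.ncard_union_eq hd3 ((hS.union (finite_shift _ _)).union (finite_shift _ _))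
    (finite_shift _ _), Set.ncard_union_eq hd2 (hS.union (finite_shift _ _)) (finite_shift _ _),
    Set.ncard_union_eq hd1 hS (finite_shift _ _), hp, ncard_shift, ncard_shift, ncard_shift,
    ncard_shift]

end Invol

namespace Invol

/-! ### Decomposition at the first arc -/

theorem injective (π : Invol) {i j : ℕ} (h : π.toFun i = π.toFun j) : i = j := by
  rw [← π.invol i, h, π.invol]

/-- Pigeonhole on occurrences, stated in coordinates so that each contradiction below is linear
arithmetic. -/
theorem eq_or_eq_of_occ_le_two {π : Invol} (h : π.occ ≤ 2) {a b c d a' b' c' d' x y z w : ℕ}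
    (h1 : Occ π.toFun a b c d) (h2 : Occ π.toFun a' b' c' d') (h3 : Occ π.toFun x y z w) :
    (a = a' ∧ b = b' ∧ c = c' ∧ d = d') ∨ (a = x ∧ b = y ∧ c = z ∧ d = w) ∨
      (a' = x ∧ b' = y ∧ c' = z ∧ d' = w) := by
  by_contra hne
  have h4 : 2 < (occSet π.toFun).ncard := by
    rw [Set.two_lt_ncard_iff (finite_occSet π)]
    refine ⟨(a, b, c, d), (a', b', c', d'), (x, y, z, w), h1, h2, h3, ?_, ?_, ?_⟩ <;>
      · simp only [ne_eq, Prod.mk.injEq]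
        tauto
  exact absurd h (not_le.mpr h4)

variable {π : Invol}

/-- The four endpoints p < x < q < y take the values q, y, p, x. -/
theorem occ_of_arcs {p q x y : ℕ} (hp : π.toFun p = q) (hx : π.toFun x = y) (h1 : p < x)
    (h2 : x < q) (h3 : q < y) : Occ π.toFun p x q y := by
  have h4 : π.toFun q = p := by rw [← hp, π.invol]
  have h5 : π.toFun y = x := by rw [← hx, π.invol]
  unfold Occ
  omega

/-- At most one arc crosses a given arc from the right. -/
theorem not_two_cross_right (h : π.occ ≤ 2) {p x y : ℕ} (h1 : p < x) (h2 : x < y)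
    (h3 : y < π.toFun p) (h4 : π.toFun p < π.toFun x) (h5 : π.toFun p < π.toFun y) : False := by
  have o1 := occ_of_arcs (π := π) rfl rfl h1 (h2.trans h3) h4
  have o2 := occ_of_arcs (π := π) rfl rfl (h1.trans h2) h3 h5
  rcases lt_trichotomy (π.toFun x) (π.toFun y) with h6 | h6 | h6
  · have := eq_or_eq_of_occ_le_two h o1 o2
      (occ_of_arcs (π := π) rfl rfl h2 (h3.trans h4) h6)
    omega
  · exact absurd (π.injective h6) h2.ne
  · have o3 : Occ π.toFun p x (π.toFun p) (π.toFun y) := by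
      unfold Occ
      rw [π.invol, π.invol]
      omega
    have := eq_or_eq_of_occ_le_two h o1 o2 o3
    omega

/-- At most one arc crosses a given arc from the left. -/
theorem not_two_cross_left (h : π.occ ≤ 2) {p x y : ℕ} (h1 : x < y) (h2 : y < p)
    (h3 : p < π.toFun x) (h4 : p < π.toFun y) (h5 : π.toFun x < π.toFun p)
    (h6 : π.toFun y < π.toFun p) : False := by
  have o1 := occ_of_arcs (π := π) rfl rfl (h1.trans h2) h3 h5
  have o2 := occ_of_arcs (π := π) rfl rfl h2 h4 h6
  rcases lt_trichotomy (π.toFun x) (π.toFun y) with h7 | h7 | h7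
  · have := eq_or_eq_of_occ_le_two h o1 o2
      (occ_of_arcs (π := π) rfl rfl h1 (h2.trans h3) h7)
    omega
  · exact absurd (π.injective h7) h1.ne
  · have o3 : Occ π.toFun y p (π.toFun x) (π.toFun p) := by
      unfold Occ
      rw [π.invol, π.invol]
      omega
    have := eq_or_eq_of_occ_le_two h o1 o2 o3
    omega

/-- The part of an involution covered by two crossing arcs decreases. -/
theorem anti_of_cross (h : π.occ ≤ 2) {p x i j : ℕ} (h1 : p < x) (h2 : x < π.toFun p)
    (h3 : π.toFun p < π.toFun x) (h4 : x < i) (h5 : i < j) (h6 : j < π.toFun p)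
    (h7 : x < π.toFun i) (h8 : π.toFun j < π.toFun p) : π.toFun j < π.toFun i := by
  rcases lt_trichotomy (π.toFun i) (π.toFun j) with h9 | h9 | h9
  · have o1 := occ_of_arcs (π := π) rfl rfl h1 h2 h3
    -- An ascent can serve as the "12" after the left ends of the crossing and as the "34" before
    -- its right ends.
    have o2 : Occ π.toFun p x i j := by
      unfold Occ
      omega
    have o3 : Occ π.toFun i j (π.toFun p) (π.toFun x) := by
      unfold Occ
      rw [π.invol, π.invol]
      omega
    have := eq_or_eq_of_occ_le_two h o1 o2 o3
    omega
  · exact absurd (π.injective h9) h5.ne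
  · exact h9

/-- A decreasing self-map of a finite integer interval is its reversal: counting from the left end
bounds f(i) above, counting from the right end bounds it below. -/
theorem eq_reflection_of_anti {f : ℕ → ℕ} {b c : ℕ} (hf : ∀ i, b < i → i < c → b < f i ∧ f i < c)
    (ha : ∀ i j, b < i → i < j → j < c → f j < f i) (i : ℕ) (h1 : b < i) (h2 : i < c) :
    f i = b + c - i := by
  have up : ∀ k, b + 1 + k < c → f (b + 1 + k) + k + 1 ≤ c := by
    intro k
    induction k with
    | zero => intro hk; have := hf (b + 1 + 0) (by omega) hk; omega
    | succ k ih =>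
      intro hk
      have := ih (by omega)
      have := ha (b + 1 + k) (b + 1 + (k + 1)) (by omega) (by omega) hk
      omega
  have down : ∀ k, b + 1 + k < c → b + 1 + k ≤ f (c - (k + 1)) := by
    intro k
    induction k with
    | zero => intro hk; have := hf (c - (0 + 1)) (by omega) (by omega); omega
    | succ k ih =>
      intro hk
      have := ih (by omega)
      have := ha (c - (k + 1 + 1)) (c - (k + 1)) (by omega) (by omega) (by omega)
      omega
  have h3 := up (i - (b + 1)) (by omega)
  have h4 := down (c - (i + 1)) (by omega)
  rw [show b + 1 + (i - (b + 1)) = i by omega] at h3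
  rw [show c - (c - (i + 1) + 1) = i by omega] at h4
  omega

/-- The decomposition of an involution with at most two occurrences of `3412` at its first arc. -/
theorem exists_decomposition (h : π.occ ≤ 2) : π.size = 0 ∨ (∃ r, IsFix π r) ∨
    (∃ g r c, IsArc π g r c) ∨ (∃ g k v r b c d, IsCross π g k v r b c d) ∨
    ∃ g j v k u r b c d e f, IsChain π g j v k u r b c d e f := by
  rcases Nat.eq_zero_or_pos π.size with h0 | h0
  · exact Or.inl h0
  refine Or.inr ?_
  have symm : ∀ {i j}, π.toFun i = j → π.toFun j = i := fun {i j} hij => by rw [← hij, π.invol]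
  obtain ⟨c, hc⟩ : ∃ c, π.toFun 0 = c := ⟨_, rfl⟩
  have hcn : c < π.size := hc ▸ π.toFun_lt h0
  have hc' := symm hc
  have n0 : ∀ {i}, π.toFun i = 0 → i = c := fun hi => (symm hi).symm.trans hc
  have nc : ∀ {i}, π.toFun i = c → i = 0 := fun hi => (symm hi).symm.trans hc'
  rcases Nat.eq_zero_or_pos c with rfl | hc0
  · obtain ⟨r, hr, hb⟩ := π.exists_block 1 (π.size - 1) fun i hi hi' => by
      have := π.toFun_lt (show i < π.size by omega)
      have := mt (n0 (i := i)) (by omega)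
      omega
    exact Or.inl ⟨r, by omega, hc, hb⟩
  refine Or.inr ?_
  -- The arc (0, c) starts at the first point, so it can only be crossed from the right.
  by_cases hx : ∃ b, 0 < b ∧ b < c ∧ c < π.toFun b
  swap
  · have hin : ∀ i, 0 < i → i < c → 0 < π.toFun i ∧ π.toFun i < c := fun i hi hi' => by
      have := mt (n0 (i := i)) (by omega)
      have := mt (nc (i := i)) (by omega)
      have := mt (fun hl => ⟨i, hi, hi', hl⟩) hx
      omega
    obtain ⟨g, hg, hgb⟩ := π.exists_block 1 (c - 1) fun i hi hi' => by
      have := hin i hi (by omega)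
      omega
    obtain ⟨r, hr, hb⟩ := π.exists_block (c + 1) (π.size - (c + 1)) fun i hi hi' => by
      have := π.toFun_lt (show i < π.size by omega)
      have := mt (n0 (i := i)) (by omega)
      have := mt (nc (i := i)) (by omega)
      have := hin (π.toFun i)
      rw [π.invol] at this
      omega
    exact Or.inl ⟨g, r, c, by omega, by omega, hc, hgb, hb⟩
  refine Or.inr ?_
  obtain ⟨b, hb0, hbc, hcd⟩ := hx
  obtain ⟨d, hd⟩ : ∃ d, π.toFun b = d := ⟨_, rfl⟩
  rw [hd] at hcd
  have hd' := symm hd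
  have hdn : d < π.size := hd ▸ π.toFun_lt (by omega)
  have nb : ∀ {i}, π.toFun i = b → i = d := fun hi => (symm hi).symm.trans hd
  have nd : ∀ {i}, π.toFun i = d → i = b := fun hi => (symm hi).symm.trans hd'
  have one : ∀ i, 0 < i → i < c → i ≠ b → π.toFun i < c := fun i h1 h2 h3 => by
    by_contra h4
    have h5 : c < π.toFun i := by
      have := mt (nc (i := i)) (by omega)
      omega
    rcases lt_or_gt_of_ne h3 with h6 | h6
    · exact not_two_cross_right h h1 h6 (by omega) (by omega) (by omega)
    · exact not_two_cross_right h hb0 h6 (by omega) (by omega) (by omega)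
  -- Otherwise (i, π i) and (0, c) would both cross (b, d) from the left.
  have hB : ∀ i, 0 < i → i < b → 0 < π.toFun i ∧ π.toFun i < b := fun i h1 h2 => by
    have h3 := one i h1 (by omega) (by omega)
    have h4 := mt (n0 (i := i)) (by omega)
    have h5 := mt (nb (i := i)) (by omega)
    by_contra h6
    exact not_two_cross_left h h1 h2 (by omega) (by omega) (by omega) (by omega)
  have hM : ∀ i, b < i → i < c → b < π.toFun i ∧ π.toFun i < c := fun i h1 h2 => by
    have h3 := one i (by omega) h2 (by omega)
    have h4 := mt (n0 (i := i)) (by omega)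
    have h5 := mt (nb (i := i)) (by omega)
    have h6 := hB (π.toFun i)
    rw [π.invol] at h6
    omega
  have hM' := eq_reflection_of_anti hM fun i j h1 h2 h3 => by
    have h4 := hM i h1 (by omega)
    have h5 := hM j (by omega) h3
    exact anti_of_cross h hb0 (by omega) (by omega) h1 h2 (by omega) h4.1 (by omega)
  have hG : ∀ i, c < i → i ≠ d → c < π.toFun i := fun i h1 h2 => by
    have h3 := mt (n0 (i := i)) (by omega)
    have h4 := mt (nb (i := i)) (by omega)
    have h5 := mt (nc (i := i)) (by omega)
    have h6 := hB (π.toFun i)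
    have h7 := hM (π.toFun i)
    rw [π.invol] at h6 h7
    omega
  obtain ⟨g, hg, hgb⟩ := π.exists_block 1 (b - 1) fun i hi hi' => by
    have := hB i hi (by omega)
    omega
  -- The remaining freedom: a further arc may cross (b, d) from the right, starting beyond `c`.
  by_cases hy : ∃ x, c < x ∧ x < d ∧ d < π.toFun x
  swap
  · have hin : ∀ i, c < i → i < d → c < π.toFun i ∧ π.toFun i < d := fun i h1 h2 => by
      have h3 := hG i h1 (by omega)
      have h4 := mt (nd (i := i)) (by omega)
      have h5 := mt (fun hl => ⟨i, h1, h2, hl⟩) hy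
      omega
    obtain ⟨v, hv, hvb⟩ := π.exists_block (c + 1) (d - (c + 1)) fun i hi hi' => by
      have := hin i hi (by omega)
      omega
    obtain ⟨r, hr, hrb⟩ := π.exists_block (d + 1) (π.size - (d + 1)) fun i hi hi' => by
      have h1 := π.toFun_lt (show i < π.size by omega)
      have h2 := hG i (by omega) (by omega)
      have h3 := mt (nd (i := i)) (by omega)
      have h4 := hin (π.toFun i)
      rw [π.invol] at h4
      omega
    exact Or.inl ⟨g, c - (b + 1), v, r, b, c, d, by omega, by omega, by omega, by omega, hc, hd,
      hgb, hM', hvb, hrb⟩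
  refine Or.inr ?_
  obtain ⟨x, hcx, hxd, hxy⟩ := hy
  obtain ⟨y, hy⟩ : ∃ y, π.toFun x = y := ⟨_, rfl⟩
  rw [hy] at hxy
  have hy' := symm hy
  have hyn : y < π.size := hy ▸ π.toFun_lt (by omega)
  have nx : ∀ {i}, π.toFun i = x → i = y := fun hi => (symm hi).symm.trans hy
  have ny : ∀ {i}, π.toFun i = y → i = x := fun hi => (symm hi).symm.trans hy'
  -- These two crossings exhaust the allowance, so any crossing with the third arc other than `o2`
  -- is excluded.
  have o1 := occ_of_arcs hc hd hb0 hbc hcd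
  have o2 := occ_of_arcs hd hy (by omega) hxd hxy
  have one' : ∀ i, c < i → i < d → i ≠ x → π.toFun i < d := fun i h1 h2 h3 => by
    by_contra h4
    have h5 := mt (nd (i := i)) (by omega)
    rcases lt_or_gt_of_ne h3 with h6 | h6
    · exact not_two_cross_right h (show b < i by omega) h6 (by omega) (by omega) (by omega)
    · exact not_two_cross_right h (show b < x by omega) h6 (by omega) (by omega) (by omega)
  have hB' : ∀ i, c < i → i < x → c < π.toFun i ∧ π.toFun i < x := fun i h1 h2 => by
    have h3 := one' i h1 (by omega) (by omega)
    have h4 := hG i h1 (by omega)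
    have h5 := mt (nx (i := i)) (by omega)
    by_contra h6
    have := eq_or_eq_of_occ_le_two h o1 o2 (occ_of_arcs (π := π) rfl hy h2 (by omega) (by omega))
    omega
  have hN : ∀ i, x < i → i < d → x < π.toFun i ∧ π.toFun i < d := fun i h1 h2 => by
    have h3 := one' i (by omega) h2 (by omega)
    have h4 := hG i (by omega) (by omega)
    have h5 := mt (nx (i := i)) (by omega)
    have h6 := hB' (π.toFun i)
    rw [π.invol] at h6
    omega
  have hN' := eq_reflection_of_anti hN fun i j h1 h2 h3 => by
    have h4 := hN i h1 (by omega)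
    have h5 := hN j (by omega) h3
    exact anti_of_cross h (show b < x by omega) (by omega) (by omega) h1 h2 (by omega) h4.1
      (by omega)
  have hG' : ∀ i, d < i → i ≠ y → d < π.toFun i := fun i h1 h2 => by
    have h3 := hG i (by omega) (by omega)
    have h4 := mt (nd (i := i)) (by omega)
    have h5 := mt (nx (i := i)) (by omega)
    have h6 := hB' (π.toFun i)
    have h7 := hN (π.toFun i)
    rw [π.invol] at h6 h7
    omega
  have hU : ∀ i, d < i → i < y → d < π.toFun i ∧ π.toFun i < y := fun i h1 h2 => by
    have h3 := hG' i h1 (by omega)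
    have h4 := mt (ny (i := i)) (by omega)
    by_contra h5
    have := eq_or_eq_of_occ_le_two h o1 o2
      (occ_of_arcs (π := π) hy rfl (show x < i by omega) h2 (by omega))
    omega
  obtain ⟨v, hv, hvb⟩ := π.exists_block (c + 1) (x - (c + 1)) fun i hi hi' => by
    have := hB' i hi (by omega)
    omega
  obtain ⟨u, hu, hub⟩ := π.exists_block (d + 1) (y - (d + 1)) fun i hi hi' => by
    have := hU i hi (by omega)
    omega
  obtain ⟨r, hr, hrb⟩ := π.exists_block (y + 1) (π.size - (y + 1)) fun i hi hi' => by
    have h1 := π.toFun_lt (show i < π.size by omega)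
    have h2 := hG' i (by omega) (by omega)
    have h3 := mt (ny (i := i)) (by omega)
    have h4 := hU (π.toFun i)
    rw [π.invol] at h4
    omega
  exact ⟨g, c - (b + 1), v, d - (x + 1), u, r, b, c, x, d, y, by omega, by omega, by omega,
    by omega, by omega, by omega, hc, hd, hy, hgb, hM', hvb, hN', hub, hrb⟩

end Invol

namespace Invol

variable {π π' g h u r g' h' u' r' : Invol} {j k b c d e f j' k' b' c' d' e' f' : ℕ}

/-! ### Each shape determines its pieces and is determined by them -/

theorem Block.congr_above {l n : ℕ} (hs : π.size = l + r.size) (hs' : π'.size = l + r.size)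
    (hb : Block π.toFun l r) (hb' : Block π'.toFun l r) (hn : l ≤ n) :
    π.toFun n = π'.toFun n := by
  rcases lt_or_ge n (l + r.size) with h | h
  · exact hb.congr hb' hn h
  · rw [π.fixed n (by omega), π'.fixed n (by omega)]

theorem IsFix.eq (H : IsFix π r) (H' : IsFix π' r) : π = π' := by
  refine Invol.ext (H.size_eq.trans H'.size_eq.symm) (funext fun i => ?_)
  rcases Nat.eq_zero_or_pos i with rfl | hi
  · rw [H.zero, H'.zero]
  · exact H.block.congr_above H.size_eq H'.size_eq H'.block hi

theorem IsArc.eq (H : IsArc π g r c) (H' : IsArc π' g r c') : π = π' := by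
  obtain rfl : c = c' := H.c_eq.trans H'.c_eq.symm
  have hc := H.c_eq
  refine Invol.ext (H.size_eq.trans H'.size_eq.symm) (funext fun i => ?_)
  rcases Nat.eq_zero_or_pos i with rfl | hi
  · rw [H.zero, H'.zero]
  rcases lt_trichotomy i c with h1 | h1 | h1
  · exact H.inner.congr H'.inner hi (by omega)
  · have h2 := H.loc i
    have h3 := H'.loc i
    omega
  · exact H.block.congr_above H.size_eq H'.size_eq H'.block h1

theorem IsCross.eq (H : IsCross π g k h r b c d) (H' : IsCross π' g k h r b' c' d') : π = π' := by
  obtain rfl : b = b' := H.b_eq.trans H'.b_eq.symm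
  obtain rfl : c = c' := H.c_eq.trans H'.c_eq.symm
  obtain rfl : d = d' := H.d_eq.trans H'.d_eq.symm
  have hb := H.b_eq
  have hc := H.c_eq
  have hd := H.d_eq
  refine Invol.ext (H.size_eq.trans H'.size_eq.symm) (funext fun i => ?_)
  have h2 := H.loc i
  have h3 := H'.loc i
  by_cases hi1 : 1 ≤ i ∧ i < b
  · exact H.inner.congr H'.inner hi1.1 (by omega)
  by_cases hi2 : c < i ∧ i < d
  · exact H.inner'.congr H'.inner' hi2.1 (by omega)
  by_cases hi3 : d < i
  · exact H.block.congr_above H.size_eq H'.size_eq H'.block hi3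
  omega

theorem IsChain.eq (H : IsChain π g j h k u r b c d e f)
    (H' : IsChain π' g j h k u r b' c' d' e' f') : π = π' := by
  obtain rfl : b = b' := H.b_eq.trans H'.b_eq.symm
  obtain rfl : c = c' := H.c_eq.trans H'.c_eq.symm
  obtain rfl : d = d' := H.d_eq.trans H'.d_eq.symm
  obtain rfl : e = e' := H.e_eq.trans H'.e_eq.symm
  obtain rfl : f = f' := H.f_eq.trans H'.f_eq.symm
  have hb := H.b_eq
  have hc := H.c_eq
  have hd := H.d_eq
  have he := H.e_eq
  have hf := H.f_eq
  refine Invol.ext (H.size_eq.trans H'.size_eq.symm) (funext fun i => ?_)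
  by_cases hi1 : 1 ≤ i ∧ i < b
  · exact H.inner.congr H'.inner hi1.1 (by omega)
  by_cases hi2 : c < i ∧ i < d
  · exact H.inner'.congr H'.inner' hi2.1 (by omega)
  by_cases hi4 : e < i ∧ i < f
  · exact H.inner''.congr H'.inner'' hi4.1 (by omega)
  by_cases hi3 : f < i
  · exact H.block.congr_above H.size_eq H'.size_eq H'.block hi3
  have h3 := H'.loc i
  rcases H.loc i with h2 | h2 | h2 | h2 | h2 | h2 | h2 | h2 | h2 | h2 | h2 | h2 <;> omega

theorem IsFix.unique (H : IsFix π r) (H' : IsFix π r') : r = r' :=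
  H.block.unique H'.block (by have := H.size_eq; have := H'.size_eq; omega)

theorem IsArc.unique (H : IsArc π g r c) (H' : IsArc π g' r' c') : g = g' ∧ r = r' := by
  obtain rfl : c = c' := H.zero.symm.trans H'.zero
  have h1 := H.c_eq
  have h2 := H'.c_eq
  have h3 := H.size_eq
  have h4 := H'.size_eq
  exact ⟨H.inner.unique H'.inner (by omega), H.block.unique H'.block (by omega)⟩

/-- `c` is π(0), and `b` is the only position between 0 and `c` whose value exceeds `c`; the blocks
follow. -/
theorem IsCross.unique (H : IsCross π g k h r b c d) (H' : IsCross π g' k' h' r' b' c' d') :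
    g = g' ∧ k = k' ∧ h = h' ∧ r = r' := by
  obtain rfl : c = c' := H.zero.symm.trans H'.zero
  have h1 := H.b_eq
  have h2 := H'.b_eq
  have h3 := H.c_eq
  have h4 := H'.c_eq
  have h5 := H.d_eq
  have h6 := H'.d_eq
  have h7 := H.size_eq
  have h8 := H'.size_eq
  have h9 := H.second
  have h10 := H'.second
  obtain rfl : b = b' := by
    have h11 := H.loc b'
    have h12 := H'.loc b
    omega
  obtain rfl : d = d' := h9.symm.trans h10
  exact ⟨H.inner.unique H'.inner (by omega), by omega, H.inner'.unique H'.inner' (by omega),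
    H.block.unique H'.block (by omega)⟩

theorem IsChain.unique (H : IsChain π g j h k u r b c d e f)
    (H' : IsChain π g' j' h' k' u' r' b' c' d' e' f') :
    g = g' ∧ j = j' ∧ h = h' ∧ k = k' ∧ u = u' ∧ r = r' := by
  obtain rfl : c = c' := H.zero.symm.trans H'.zero
  have h1 := H.b_eq
  have h2 := H'.b_eq
  have h3 := H.c_eq
  have h4 := H'.c_eq
  have h5 := H.d_eq
  have h6 := H'.d_eq
  have h5' := H.e_eq
  have h6' := H'.e_eq
  have h5'' := H.f_eq
  have h6'' := H'.f_eq
  have h7 := H.size_eq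
  have h8 := H'.size_eq
  have h9 := H.second
  have h10 := H'.second
  have h9' := H.third
  have h10' := H'.third
  obtain rfl : b = b' := by
    rcases lt_trichotomy b b' with hl | hl | hl
    · have := H'.inner.mem (i := b) (by omega) (by omega)
      omega
    · exact hl
    · have := H.inner.mem (i := b') (by omega) (by omega)
      omega
  obtain rfl : e = e' := h9.symm.trans h10
  obtain rfl : d = d' := by
    rcases lt_trichotomy d d' with hl | hl | hl
    · have := H'.inner'.mem (i := d) (by omega) (by omega)
      omega
    · exact hl
    · have := H.inner'.mem (i := d') (by omega) (by omega)
      omega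
  obtain rfl : f = f' := h9'.symm.trans h10'
  exact ⟨H.inner.unique H'.inner (by omega), by omega, H.inner'.unique H'.inner' (by omega),
    by omega, H.inner''.unique H'.inner'' (by omega), H.block.unique H'.block (by omega)⟩

theorem IsArc.not_isCross (H : IsArc π g r c) (H' : IsCross π g' k' h' r' b' c' d') : False := by
  obtain rfl : c = c' := H.zero.symm.trans H'.zero
  have h1 := H.loc b'
  have h2 := H'.second
  have h3 := H'.b_eq
  have h4 := H'.c_eq
  have h5 := H'.d_eq
  omega

theorem IsArc.not_isChain (H : IsArc π g r c) (H' : IsChain π g' j' h' k' u' r' b' c' d' e' f') :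
    False := by
  obtain rfl : c = c' := H.zero.symm.trans H'.zero
  have h1 := H.loc b'
  have h2 := H'.second
  have h3 := H'.b_eq
  have h4 := H'.c_eq
  have h5 := H'.d_eq
  have h6 := H'.e_eq
  omega

/-- The first two arcs would agree, and the third arc of the chain would start inside the block
between `c` and `d` and leave it. -/
theorem IsCross.not_isChain (H : IsCross π g k h r b c d)
    (H' : IsChain π g' j' h' k' u' r' b' c' d' e' f') : False := by
  obtain rfl : c = c' := H.zero.symm.trans H'.zero
  have h1 := H.b_eq
  have h2 := H'.b_eq
  have h3 := H.c_eq
  have h4 := H'.c_eq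
  have h5 := H.d_eq
  have h6 := H'.d_eq
  have h6' := H'.e_eq
  have h6'' := H'.f_eq
  have h9 := H.second
  have h10 := H'.second
  have h10' := H'.third
  obtain rfl : b = b' := by
    rcases lt_trichotomy b b' with hl | hl | hl
    · have := H'.inner.mem (i := b) (by omega) (by omega)
      omega
    · exact hl
    · have := H.inner.mem (i := b') (by omega) (by omega)
      omega
  obtain rfl : d = e' := h9.symm.trans h10
  have := H.inner'.mem (i := d') (by omega) (by omega)
  omega

end Invol

open Invol

/-! ### Comparison with permutations of `Fin n` -/

/-- Restricting to `Fin n` identifies `Invol` at size `n` with the involutions of `Fin n`. -/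
noncomputable def involEquiv (n : ℕ) :
    {π : Invol // π.size = n} ≃ {σ : Equiv.Perm (Fin n) // σ = σ⁻¹} where
  toFun π :=
    have h : Function.Involutive fun i : Fin n =>
        (⟨π.1.toFun i, (π.1.toFun_lt (i.2.trans_eq π.2.symm)).trans_eq π.2⟩ : Fin n) :=
      fun i => Fin.ext (π.1.invol i)
    ⟨h.toPerm, h.toPerm_symm.symm⟩
  invFun σ :=
    ⟨⟨n, fun i => if hi : i < n then σ.1 ⟨i, hi⟩ else i, fun i => by
      by_cases hi : i < n
      · have h : σ.1 (σ.1 ⟨i, hi⟩) = ⟨i, hi⟩ := by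
          nth_rewrite 1 [σ.2]
          exact σ.1.symm_apply_apply _
        simp [hi, h]
      · simp [hi], fun i hi => dif_neg (not_lt.mpr hi)⟩, rfl⟩
  left_inv π := by
    obtain ⟨π, rfl⟩ := π
    refine Subtype.ext (Invol.ext rfl (funext fun i => ?_))
    by_cases hi : i < π.size
    · simp only [hi, dif_pos]
      rfl
    · simp [hi, π.fixed i (not_lt.mp hi)]
  right_inv σ := by
    refine Subtype.ext (Equiv.ext fun i => Fin.ext ?_)
    simp

theorem involEquiv_apply {n : ℕ} (π : {π : Invol // π.size = n}) (i : Fin n) :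
    (((involEquiv n π).1 i : Fin n) : ℕ) = π.1.toFun i :=
  rfl

theorem isOccurrence_iff {n : ℕ} (σ : Equiv.Perm (Fin n)) (f : Fin 4 ↪o Fin n) :
    IsOccurrence pattern3412 σ f ↔
      σ (f 2) < σ (f 3) ∧ σ (f 3) < σ (f 0) ∧ σ (f 0) < σ (f 1) := by
  constructor
  · intro h
    exact ⟨(h 2 3).mp (by decide), (h 3 0).mp (by decide), (h 0 1).mp (by decide)⟩
  · rintro ⟨h1, h2, h3⟩ a b
    fin_cases a <;> fin_cases b <;>
      simp [pattern3412] <;> order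

theorem occurrences_involEquiv {n : ℕ} (π : {π : Invol // π.size = n}) :
    occurrences pattern3412 (involEquiv n π).1 = π.1.occ := by
  rw [occurrences, Invol.occ, ← Nat.card_coe_set_eq]
  refine Nat.card_congr (Equiv.ofBijective (fun f => ⟨((f.1 0 : ℕ), (f.1 1 : ℕ), (f.1 2 : ℕ),
    (f.1 3 : ℕ)), ?_⟩) ⟨?_, ?_⟩)
  · have h := (isOccurrence_iff _ _).mp f.2
    simp only [Fin.lt_def, involEquiv_apply] at h
    exact ⟨f.1.strictMono (show (0 : Fin 4) < 1 by decide),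
      f.1.strictMono (show (1 : Fin 4) < 2 by decide),
      f.1.strictMono (show (2 : Fin 4) < 3 by decide), h⟩
  · rintro ⟨f, _⟩ ⟨f', _⟩ hff
    replace hff := congrArg Subtype.val hff
    simp only [Prod.mk.injEq, Fin.val_inj] at hff
    refine Subtype.ext (RelEmbedding.ext fun i => ?_)
    fin_cases i
    exacts [hff.1, hff.2.1, hff.2.2.1, hff.2.2.2]
  · rintro ⟨⟨x, y, z, w⟩, (hq : Occ π.1.toFun x y z w)⟩
    have hw : w < n := π.2 ▸ lt_size_of_occ hq
    obtain ⟨h1, h2, h3, h4⟩ := hq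
    let f : Fin 4 ↪o Fin n := OrderEmbedding.ofStrictMono
      ![⟨x, by omega⟩, ⟨y, by omega⟩, ⟨z, by omega⟩, ⟨w, hw⟩] (by
        rw [Fin.strictMono_iff_lt_succ]
        intro i
        fin_cases i
        exacts [h1, h2, h3])
    exact ⟨⟨f, (isOccurrence_iff _ _).mpr h4⟩, rfl⟩

noncomputable instance : Graded Invol where
  size := Invol.size
  weight := Invol.occ
  finite_size n := Set.finite_coe_iff.mp (Finite.of_equiv _ (involEquiv n).symm)

theorem involutionGF_eq (r : ℕ) : involutionGF r = gradedGF Invol r := by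
  ext n
  simp only [involutionGF, gradedGF, PowerSeries.coeff_mk, involutionCount]
  rw [← Nat.card_coe_set_eq, Nat.cast_inj]
  refine Nat.card_congr ?_
  refine (Equiv.subtypeSubtypeEquivSubtypeInter _ _).symm.trans
    (Equiv.trans ?_ (Equiv.subtypeSubtypeEquivSubtypeInter _ _))
  refine (Equiv.subtypeEquiv (involEquiv n) fun π => ?_).symm
  rw [occurrences_involEquiv]
  rfl

/-! ### The class of constructions -/

/-- The ways to build an involution with at most two occurrences of `3412` from smaller ones:
the empty involution, a fixed point, an arc, two crossing arcs, or a chain of three arcs. -/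
abbrev Construction : Type :=
  Atom 0 0 ⊕ Atom 1 0 × Invol ⊕ Atom 2 0 × Invol × Invol ⊕
    Atom 4 1 × ℕ × Invol × Invol × Invol ⊕
    Atom 6 2 × ℕ × ℕ × Invol × Invol × Invol × Invol

/-- `π` is built by the given construction. -/
def IsBuilt (π : Invol) : Construction → Prop
  | .inl _ => π.size = 0
  | .inr (.inl (_, r)) => IsFix π r
  | .inr (.inr (.inl (_, g, r))) => ∃ c, IsArc π g r c
  | .inr (.inr (.inr (.inl (_, k, g, h, r)))) => ∃ b c d, IsCross π g k h r b c d
  | .inr (.inr (.inr (.inr (_, j, k, g, h, u, r)))) =>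
    ∃ b c d e f, IsChain π g j h k u r b c d e f

theorem exists_isBuilt (t : Construction) : ∃ π, IsBuilt π t := by
  rcases t with _ | ⟨_, r⟩ | ⟨_, g, r⟩ | ⟨_, k, g, h, r⟩ | ⟨_, j, k, g, h, u, r⟩
  · exact ⟨⟨0, id, fun _ => rfl, fun _ _ => rfl⟩, rfl⟩
  · exact exists_isFix r
  · exact (exists_isArc g r).imp fun π h => ⟨_, h⟩
  · exact (exists_isCross g k h r).imp fun π h => ⟨_, _, _, h⟩
  · exact exists_isChain g j h k u r

theorem IsBuilt.eq {π π' : Invol} {t : Construction} (H : IsBuilt π t) (H' : IsBuilt π' t) :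
    π = π' := by
  rcases t with _ | ⟨_, r⟩ | ⟨_, g, r⟩ | ⟨_, k, g, h, r⟩ | ⟨_, j, k, g, h, u, r⟩
  · refine Invol.ext (Eq.trans H (Eq.symm H')) (funext fun i => ?_)
    rw [π.fixed i (le_of_eq_of_le H i.zero_le), π'.fixed i (le_of_eq_of_le H' i.zero_le)]
  · exact IsFix.eq H H'
  · obtain ⟨c, H⟩ := H
    obtain ⟨c', H'⟩ := H'
    exact H.eq H'
  · obtain ⟨b, c, d, H⟩ := H
    obtain ⟨b', c', d', H'⟩ := H'
    exact H.eq H'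
  · obtain ⟨b, c, d, e, f, H⟩ := H
    obtain ⟨b', c', d', e', f', H'⟩ := H'
    exact H.eq H'

theorem IsBuilt.size_eq {π : Invol} {t : Construction} (H : IsBuilt π t) :
    Graded.size π = Graded.size t := by
  rcases t with _ | ⟨_, r⟩ | ⟨_, g, r⟩ | ⟨_, k, g, h, r⟩ | ⟨_, j, k, g, h, u, r⟩
  · exact H
  · exact IsFix.size_eq H
  · obtain ⟨c, H⟩ := H
    have h1 := H.size_eq
    have h2 := H.c_eq
    change π.size = 2 + (g.size + r.size)
    omega
  · obtain ⟨b, c, d, H⟩ := H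
    have h1 := H.size_eq
    have h2 := H.b_eq
    have h3 := H.c_eq
    have h4 := H.d_eq
    change π.size = 4 + (k + (g.size + (h.size + r.size)))
    omega
  · obtain ⟨b, c, d, e, f, H⟩ := H
    have h1 := H.size_eq
    have h2 := H.b_eq
    have h3 := H.c_eq
    have h4 := H.d_eq
    have h5 := H.e_eq
    have h6 := H.f_eq
    change π.size = 6 + (j + (k + (g.size + (h.size + (u.size + r.size)))))
    omega

theorem IsBuilt.weight_eq {π : Invol} {t : Construction} (H : IsBuilt π t) :
    Graded.weight π = Graded.weight t := by
  rcases t with _ | ⟨_, r⟩ | ⟨_, g, r⟩ | ⟨_, k, g, h, r⟩ | ⟨_, j, k, g, h, u, r⟩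
  · change π.occ = 0
    rw [Invol.occ, Set.ncard_eq_zero (finite_occSet π), Set.eq_empty_iff_forall_notMem]
    rintro ⟨x, y, z, w⟩ hq
    have h1 : w < π.size := lt_size_of_occ hq
    have h2 : π.size = 0 := H
    omega
  · change π.occ = 0 + r.occ
    rw [IsFix.occ_eq H]
    omega
  · obtain ⟨c, H⟩ := H
    change π.occ = 0 + (g.occ + r.occ)
    rw [H.occ_eq]
    omega
  · obtain ⟨b, c, d, H⟩ := H
    change π.occ = 1 + (0 + (g.occ + (h.occ + r.occ)))
    rw [H.occ_eq]
    omega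
  · obtain ⟨b, c, d, e, f, H⟩ := H
    change π.occ = 2 + (0 + (0 + (g.occ + (h.occ + (u.occ + r.occ)))))
    rw [H.occ_eq]
    omega

/-- Size separates the empty case, the value at 0 separates the fixed point, and the crossing
pattern of the first arc separates the rest. -/
theorem IsBuilt.unique {π : Invol} {t t' : Construction} (H : IsBuilt π t) (H' : IsBuilt π t') :
    t = t' := by
  have arc_pos : ∀ {g r : Invol}, (∃ c, IsArc π g r c) → π.size ≠ 0 ∧ π.toFun 0 ≠ 0 := by
    rintro g r ⟨c, H⟩
    rw [H.size_eq, H.zero, H.c_eq]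
    omega
  have cross_pos : ∀ {g k h r}, (∃ b c d, IsCross π g k h r b c d) →
      π.size ≠ 0 ∧ π.toFun 0 ≠ 0 := by
    rintro g k h r ⟨b, c, d, H⟩
    rw [H.size_eq, H.zero, H.c_eq]
    omega
  have chain_pos : ∀ {g j h k u r}, (∃ b c d e f, IsChain π g j h k u r b c d e f) →
      π.size ≠ 0 ∧ π.toFun 0 ≠ 0 := by
    rintro g j h k u r ⟨b, c, d, e, f, H⟩
    rw [H.size_eq, H.zero, H.c_eq]
    omega
  have fix_pos : ∀ {r}, IsFix π r → π.size ≠ 0 := fun H => by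
    rw [H.size_eq]
    omega
  rcases t with ⟨⟩ | ⟨⟨⟩, r⟩ | ⟨⟨⟩, g, r⟩ | ⟨⟨⟩, k, g, h, r⟩ | ⟨⟨⟩, j, k, g, h, u, r⟩ <;>
    rcases t' with ⟨⟩ | ⟨⟨⟩, r'⟩ | ⟨⟨⟩, g', r'⟩ | ⟨⟨⟩, k', g', h', r'⟩ |
      ⟨⟨⟩, j', k', g', h', u', r'⟩
  · rfl
  · exact absurd H (fix_pos H')
  · exact absurd H (arc_pos H').1
  · exact absurd H (cross_pos H').1
  · exact absurd H (chain_pos H').1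
  · exact absurd H' (fix_pos H)
  · rw [IsFix.unique H H']
  · exact absurd H.zero (arc_pos H').2
  · exact absurd H.zero (cross_pos H').2
  · exact absurd H.zero (chain_pos H').2
  · exact absurd H' (arc_pos H).1
  · exact absurd H'.zero (arc_pos H).2
  · obtain ⟨c, H⟩ := H
    obtain ⟨c', H'⟩ := H'
    obtain ⟨rfl, rfl⟩ := H.unique H'
    rfl
  · obtain ⟨c, H⟩ := H
    obtain ⟨b', c', d', H'⟩ := H'
    exact (H.not_isCross H').elim
  · obtain ⟨c, H⟩ := H
    obtain ⟨b', c', d', e', f', H'⟩ := H'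
    exact (H.not_isChain H').elim
  · exact absurd H' (cross_pos H).1
  · exact absurd H'.zero (cross_pos H).2
  · obtain ⟨c, H'⟩ := H'
    obtain ⟨b', c', d', H⟩ := H
    exact (H'.not_isCross H).elim
  · obtain ⟨b, c, d, H⟩ := H
    obtain ⟨b', c', d', H'⟩ := H'
    obtain ⟨rfl, rfl, rfl, rfl⟩ := H.unique H'
    rfl
  · obtain ⟨b, c, d, H⟩ := H
    obtain ⟨b', c', d', e', f', H'⟩ := H'
    exact (H.not_isChain H').elim
  · exact absurd H' (chain_pos H).1
  · exact absurd H'.zero (chain_pos H).2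
  · obtain ⟨c, H'⟩ := H'
    obtain ⟨b', c', d', e', f', H⟩ := H
    exact (H'.not_isChain H).elim
  · obtain ⟨b, c, d, H'⟩ := H'
    obtain ⟨b', c', d', e', f', H⟩ := H
    exact (H'.not_isChain H).elim
  · obtain ⟨b, c, d, e, f, H⟩ := H
    obtain ⟨b', c', d', e', f', H'⟩ := H'
    obtain ⟨rfl, rfl, rfl, rfl, rfl, rfl⟩ := H.unique H'
    rfl

theorem exists_construction {π : Invol} (h : π.occ ≤ 2) : ∃ t, IsBuilt π t := by
  rcases exists_decomposition h with h | ⟨r, h⟩ | ⟨g, r, c, h⟩ | ⟨g, k, v, r, b, c, d, h⟩ |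
    ⟨g, j, v, k, u, r, b, c, d, e, f, h⟩
  · exact ⟨.inl .mk, h⟩
  · exact ⟨.inr (.inl (.mk, r)), h⟩
  · exact ⟨.inr (.inr (.inl (.mk, g, r))), c, h⟩
  · exact ⟨.inr (.inr (.inr (.inl (.mk, k, g, v, r)))), b, c, d, h⟩
  · exact ⟨.inr (.inr (.inr (.inr (.mk, j, k, g, v, u, r)))), b, c, d, e, f, h⟩

/-- Building is injective but misses involutions with more intricate crossings; the bound on `r`
guarantees that none of those is counted. -/
theorem gradedGF_invol (r : ℕ) (hr : r ≤ 2) : gradedGF Invol r = gradedGF Construction r := by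
  choose φ hφ using exists_isBuilt
  refine gradedGF_eq_of_injective φ (fun t t' h => (hφ t).unique (h ▸ hφ t'))
    (fun t => (hφ t).size_eq) (fun t => (hφ t).weight_eq) r fun π h => ?_
  obtain ⟨t, ht⟩ := exists_construction (π := π) (h.trans_le hr)
  exact ⟨t, (hφ t).eq ht⟩

/-! ### Functional equations and closed form -/

theorem gradedGF_invol_zero : gradedGF Invol 0 =
    1 + PowerSeries.X * gradedGF Invol 0 + PowerSeries.X ^ 2 * gradedGF Invol 0 ^ 2 := by
  conv_lhs => rw [gradedGF_invol 0 (by norm_num)]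
  simp [gradedGF_sum, gradedGF_prod, gradedGF_atom]
  ring

/-- The single occurrence lies in the tail, in one of the two parts beside an arc (whence the 2), or
is the first crossing, with all three blocks free of occurrences. -/
theorem gradedGF_invol_one : gradedGF Invol 1 =
    PowerSeries.X * gradedGF Invol 1 +
      2 * PowerSeries.X ^ 2 * gradedGF Invol 0 * gradedGF Invol 1 +
      PowerSeries.X ^ 4 * PowerSeries.mk 1 * gradedGF Invol 0 ^ 3 := by
  conv_lhs => rw [gradedGF_invol 1 (by norm_num)]
  simp [gradedGF_sum, gradedGF_prod, gradedGF_atom, gradedGF_nat_zero,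
    Finset.Nat.antidiagonal_succ]
  ring

theorem gradedGF_invol_two : gradedGF Invol 2 =
    PowerSeries.X * gradedGF Invol 2 +
      PowerSeries.X ^ 2 * (2 * gradedGF Invol 0 * gradedGF Invol 2 + gradedGF Invol 1 ^ 2) +
      3 * PowerSeries.X ^ 4 * PowerSeries.mk 1 * gradedGF Invol 0 ^ 2 * gradedGF Invol 1 +
      PowerSeries.X ^ 6 * PowerSeries.mk 1 ^ 2 * gradedGF Invol 0 ^ 4 := by
  conv_lhs => rw [gradedGF_invol 2 le_rfl]
  simp [gradedGF_sum, gradedGF_prod, gradedGF_atom, gradedGF_nat_zero, gradedGF_nat_succ,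
    Finset.Nat.antidiagonal_succ]
  ring

theorem eq_sqrtSeries {f s : ℚ⟦X⟧} (hs : s ^ 2 = f) (h1 : PowerSeries.constantCoeff s = 1) :
    sqrtSeries f = s := by
  have hf : PowerSeries.constantCoeff f = 1 := by simp [← hs, h1]
  rcases sq_eq_sq_iff_eq_or_eq_neg.mp ((sqrtSeries_sq hf).trans hs.symm) with h | h
  · exact h
  · have h2 := congrArg PowerSeries.constantCoeff h
    rw [constantCoeff_sqrtSeries hf, map_neg, h1] at h2
    norm_num at h2

/-- Completing the square in the Motzkin equation. -/
theorem sqrtSeries_eq :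
    sqrtSeries (1 - 2 * (PowerSeries.X : ℚ⟦X⟧) - 3 * (PowerSeries.X : ℚ⟦X⟧) ^ 2) =
      1 - PowerSeries.X - 2 * PowerSeries.X ^ 2 * gradedGF Invol 0 :=
  eq_sqrtSeries (by linear_combination (-4 * PowerSeries.X ^ 2) * gradedGF_invol_zero) (by simp)

/-- The solution of the equations for the generating functions at weights `0`, `1`, `2`. -/
theorem weight_two_closed_form {K : Type*} [Field K] [CharZero K] {x s m a b r : K} (hx : x ≠ 0)
    (hs0 : s ≠ 0) (hr : r * (1 - x) = 1) (hs : s = 1 - x - 2 * x ^ 2 * m)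
    (hm : m = 1 + x * m + x ^ 2 * m ^ 2)
    (ha : a = x * a + 2 * x ^ 2 * m * a + x ^ 4 * r * m ^ 3)
    (hb : b = x * b + x ^ 2 * (2 * m * b + a ^ 2) + 3 * x ^ 4 * r * m ^ 2 * a +
      x ^ 6 * r ^ 2 * m ^ 4) :
    b = (1 - 2 * x) / (2 * x ^ 2 * (1 - x)) -
      (1 - 6 * x + 8 * x ^ 2 + 8 * x ^ 3 - 15 * x ^ 4 - 2 * x ^ 5 + 4 * x ^ 6) /
        (2 * x ^ 2 * (1 - x) ^ 2 * s ^ 3) := by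
  have hx1 : 1 - x ≠ 0 := right_ne_zero_of_mul_eq_one hr
  have hq : s ^ 2 = 1 - 2 * x - 3 * x ^ 2 := by
    rw [hs]
    linear_combination (-4 * x ^ 2) * hm
  -- Collecting the terms in `a` leaves the coefficient 1 - x - 2x²m = s; the same happens for `b`
  -- in `hsb`.
  have ha' : s * (1 - x) * a = x ^ 4 * m ^ 3 := by
    rw [hs]
    linear_combination (1 - x) * ha + x ^ 4 * m ^ 3 * hr
  have hsb : s * b = x ^ 2 * a ^ 2 + 3 * x ^ 4 * r * m ^ 2 * a + x ^ 6 * r ^ 2 * m ^ 4 := by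
    rw [hs]
    linear_combination hb
  have hb' : s ^ 3 * (1 - x) ^ 2 * b = x ^ 10 * m ^ 6 + 3 * x ^ 8 * m ^ 5 * s +
      x ^ 6 * m ^ 4 * s ^ 2 := by
    linear_combination s ^ 2 * (1 - x) ^ 2 * hsb +
      x ^ 2 * (s * (1 - x) * a + x ^ 4 * m ^ 3) * ha' +
      3 * x ^ 4 * m ^ 2 * s * (r * (1 - x)) * ha' + 3 * x ^ 8 * m ^ 5 * s * hr +
      x ^ 6 * m ^ 4 * s ^ 2 * (r * (1 - x) + 1) * hr
  have hu : x ^ 2 * m = (1 - x - s) / 2 := by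
    rw [hs]
    ring
  have hb'' : 2 * x ^ 2 * (1 - x) ^ 2 * s ^ 3 * b =
      2 * (((1 - x - s) / 2) ^ 6 + 3 * ((1 - x - s) / 2) ^ 5 * s +
        ((1 - x - s) / 2) ^ 4 * s ^ 2) := by
    rw [← hu]
    linear_combination 2 * x ^ 2 * hb'
  have key : 2 * x ^ 2 * (1 - x) ^ 2 * s ^ 3 * b = (1 - 2 * x) * (1 - x) * s ^ 3 -
      (1 - 6 * x + 8 * x ^ 2 + 8 * x ^ 3 - 15 * x ^ 4 - 2 * x ^ 5 + 4 * x ^ 6) := by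
    -- The multiplier of `hq` is a quotient from reducing powers of `s` modulo s² = 1 - 2x - 3x²,
    -- adjusted to leave an s³ term.
    linear_combination hb'' + (1 / 32 * (-11 * (1 - x) ^ 4 + 24 * (1 - x) ^ 3 * s -
      21 * (1 - x) ^ 2 * (s ^ 2 + (1 - 2 * x - 3 * x ^ 2)) +
      8 * (1 - x) * s * (s ^ 2 + (1 - 2 * x - 3 * x ^ 2)) -
      (s ^ 4 + s ^ 2 * (1 - 2 * x - 3 * x ^ 2) + (1 - 2 * x - 3 * x ^ 2) ^ 2)) -
      (1 - 2 * x) * (1 - x) * s) * hq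
  field_simp
  linear_combination key

/-- The equations hold among power series, but the formula divides by x², so they are transported
along an embedding into a field. -/
theorem map_involutionGF_two {K : Type*} [Field K] (φ : ℚ⟦X⟧ →+* K)
    (hφ : Function.Injective φ) {x s : K} (hx : x = φ PowerSeries.X)
    (hs : s = φ (sqrtSeries
      (1 - 2 * (PowerSeries.X : ℚ⟦X⟧) - 3 * (PowerSeries.X : ℚ⟦X⟧) ^ 2))) :
    φ (involutionGF 2) = (1 - 2 * x) / (2 * x ^ 2 * (1 - x)) -
      (1 - 6 * x + 8 * x ^ 2 + 8 * x ^ 3 - 15 * x ^ 4 - 2 * x ^ 5 + 4 * x ^ 6) /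
        (2 * x ^ 2 * (1 - x) ^ 2 * s ^ 3) := by
  have : CharZero K := charZero_of_injective_ringHom (φ.comp PowerSeries.C).injective
  rw [sqrtSeries_eq] at hs
  have hs0 : s ≠ 0 := by
    rw [hs]
    refine (map_ne_zero_iff φ hφ).mpr fun h => ?_
    simpa using congrArg PowerSeries.constantCoeff h
  have h0 := congrArg φ gradedGF_invol_zero
  have h1 := congrArg φ gradedGF_invol_one
  have h2 := congrArg φ gradedGF_invol_two
  simp only [map_add, map_sub, map_mul, map_pow, map_one, map_ofNat, ← hx] at hs h0 h1 h2
  have hx0 : x ≠ 0 := hx ▸ (map_ne_zero_iff φ hφ).mpr PowerSeries.X_ne_zero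
  have hr : φ (PowerSeries.mk 1) * (1 - x) = 1 := by
    rw [hx, ← map_one φ, ← map_sub, ← map_mul, PowerSeries.mk_one_mul_one_sub_eq_one]
  rw [involutionGF_eq]
  exact weight_two_closed_form hx0 hs0 hr hs h0 h1 h2

end PatternInvolutions

theorem corollary3p5 (x s : ℚ⸨X⸩)
    (hx : x = ((PowerSeries.X : ℚ⟦X⟧) : ℚ⸨X⸩))
    (hs : s = (PatternInvolutions.sqrtSeries
      (1 - 2 * (PowerSeries.X : ℚ⟦X⟧) - 3 * (PowerSeries.X : ℚ⟦X⟧) ^ 2) : ℚ⟦X⟧)) :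
    ((PatternInvolutions.involutionGF 2 : ℚ⟦X⟧) : ℚ⸨X⸩) =
      (1 - 2 * x) / (2 * x ^ 2 * (1 - x)) -
        (1 - 6 * x + 8 * x ^ 2 + 8 * x ^ 3 - 15 * x ^ 4 - 2 * x ^ 5 + 4 * x ^ 6) /
          (2 * x ^ 2 * (1 - x) ^ 2 * s ^ 3) := by
  exact PatternInvolutions.map_involutionGF_two (HahnSeries.ofPowerSeries ℤ ℚ)
    HahnSeries.ofPowerSeries_injective hx hs
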